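/- Let $X$ be a topological space, and let $C_X$ be the (homotopy) cofiber of the diagonal $\Delta\colon X\to X\times X$, i.e. the mapping cone $(X\times X)\cup_\Delta CX$, based at the cone point, with inclusion $q\colon X\times X\to C_X$. Let $R$ be any ring with unit, and let $H^*(-;R)=\bigoplus_n H^n(-;R)$ denote the singular cohomology ring with the cup product. The ideal of zero-divisors is $\ker\big(\Delta^*\colon H^*(X\times X;R)\to H^*(X;R)\big)$, and the zero-divisors cup-length $\mathrm{zcl}_R(X)\in\{0,1,2,\dots,\infty\}$ is the supremum of the integers $k\ge 0$ for which some product of $k$ zero-divisors is nonzero (and $0$ if there are none). For a based space $(Y,\star)$, let $\mathrm{cat}(Y)\in\{0,1,2,\dots,\infty\}$ be the (normalized) Lusternik–Schnirelmann category, i.e. the sectional category of the evaluation $e_1\colon P_0(Y)\to Y$, $\gamma\mapsto\gamma(1)$, on the space of paths with $\gamma(0)=\star$: the least $n$ such that $Y$ has a cover by $n+1$ open sets on each of which $e_1$ has a (homotopy) section, and $\infty$ if there is no such $n$. Let $\widetilde H^*(Y;R)$ be the kernel of the restriction $H^*(Y;R)\to H^*(\star;R)$. Then $$\mathrm{zcl}_R(X)\le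 \mathrm{cat}(C_X).$$ Moreover, $q^*\colon H^*(C_X;R)\to H^*(X\times X;R)$ maps $\widetilde H^*(C_X;R)$ bijectively onto the ideal of zero-divisors $\ker\Delta^*$. -/

import Mathlib

universe u v

/-! ## The cofiber of a map -/

section MappingCone

variable {A B : Type u} [TopologicalSpace A] [TopologicalSpace B]

/-- The identifications in the mapping cone: `(a, 0) ∼ f a`, and `(a, 1)` is the cone point. -/
inductive MappingCone.Rel (f : C(A, B)) : B ⊕ (A × unitInterval) ⊕ PUnit.{u + 1} →
    B ⊕ (A × unitInterval) ⊕ PUnit.{u + 1} → Prop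
  | base (a : A) : MappingCone.Rel f (.inr (.inl (a, 0))) (.inl (f a))
  | tip (a : A) : MappingCone.Rel f (.inr (.inl (a, 1))) (.inr (.inr PUnit.unit))

/-- The (homotopy) cofiber of `f : A → B`, that is, its mapping cone `B ∪_f CA`: the quotient of
the disjoint union of `B`, `A × [0, 1]` and a point, with the quotient topology. -/
def MappingCone (f : C(A, B)) : Type u := Quot (MappingCone.Rel f)

instance (f : C(A, B)) : TopologicalSpace (MappingCone f) :=
  inferInstanceAs (TopologicalSpace (Quot (MappingCone.Rel f)))

/-- The cone point, which is the base point. -/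
def MappingCone.apex (f : C(A, B)) : MappingCone f := Quot.mk _ (.inr (.inr PUnit.unit))

/-- The inclusion of the target of `f` into its mapping cone. -/
def MappingCone.incl (f : C(A, B)) : C(B, MappingCone f) :=
  ⟨fun b => Quot.mk _ (.inl b), continuous_quot_mk.comp continuous_inl⟩

end MappingCone

/-! ## Sectional category and Lusternik-Schnirelmann category -/

/-- The (reduced) sectional category of a map `p : E → B`: the least `n` such that `B` has a cover
by `n + 1` open sets on each of which `p` has a homotopy section, and `⊤` if there is none. For a
fibration `p`, a homotopy section over an open set can be deformed to a strict section. -/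
noncomputable def sectionalCategory {E : Type u} {B : Type v} [TopologicalSpace E]
    [TopologicalSpace B] (p : C(E, B)) : ℕ∞ :=
  ⨅ (n : ℕ) (_ : ∃ U : Fin (n + 1) → Set B, (∀ i, IsOpen (U i)) ∧ (⋃ i, U i) = Set.univ ∧
    ∀ i, ∃ s : C(U i, E), (p.comp s).Homotopic ⟨Subtype.val, continuous_subtype_val⟩), (n : ℕ∞)

/-- The space of paths in `Y` that start at the base point `y`, with the compact-open topology. -/
abbrev BasedPathSpace (Y : Type u) [TopologicalSpace Y] (y : Y) : Type u :=
  {γ : C(unitInterval, Y) // γ 0 = y}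

/-- The evaluation map `γ ↦ γ(1)` on the based path space. -/
def basedPathEval (Y : Type u) [TopologicalSpace Y] (y : Y) : C(BasedPathSpace Y y, Y) :=
  ⟨fun γ => γ.1 1, (continuous_eval_const (1 : unitInterval)).comp continuous_subtype_val⟩

/-- The Lusternik-Schnirelmann category of a based space, normalized so that a contractible space
has category `0`: the sectional category of the evaluation map on the based path space. -/
noncomputable def lsCategory (Y : Type u) [TopologicalSpace Y] (y : Y) : ℕ∞ :=
  sectionalCategory (basedPathEval Y y)

section SimplicialCochains

open CategoryTheory
open scoped Simplicial

/-! ## The singular cohomology ring -/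

/-- The operation `S_n → S_m` of a simplicial set given by a monotone map `[m] → [n]`. -/
def SSet.act (S : SSet.{u}) {m n : ℕ} (θ : ⦋m⦌ ⟶ ⦋n⦌) (τ : S _⦋n⦌) : S _⦋m⦌ :=
  S.map θ.op τ

/-- The inclusion `[p] → [n]` of the first `p + 1` vertices. It is only used for `p ≤ n`, where it
is `i ↦ i`; the minimum makes the formula meaningful for all `p` and `n`. -/
def frontMap (p n : ℕ) : ⦋p⦌ ⟶ ⦋n⦌ :=
  SimplexCategory.mkHom
    ⟨fun i => ⟨min i.1 n, by omega⟩, fun i j h => by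
      have h' : i.1 ≤ j.1 := h
      simp only [Fin.mk_le_mk]; omega⟩

/-- The inclusion `[q] → [n]` of the last `q + 1` vertices. It is only used for `q ≤ n`, where it
is `i ↦ (n - q) + i`; the minimum makes the formula meaningful for all `q` and `n`. -/
def backMap (q n : ℕ) : ⦋q⦌ ⟶ ⦋n⦌ :=
  SimplexCategory.mkHom
    ⟨fun i => ⟨min (n - q + i.1) n, by omega⟩, fun i j h => by
      have h' : i.1 ≤ j.1 := h
      simp only [Fin.mk_le_mk]; omega⟩

/-- Families `(f_n)` with `f_n` an `n`-cochain of the simplicial set `S` with values in `R`. -/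
structure Cochains (S : SSet.{u}) (R : Type v) : Type (max u v) where
  /-- The `n`-th term, a function on `n`-simplices. -/
  toFun : ∀ n : ℕ, S _⦋n⦌ → R

namespace Cochains

instance {S : SSet.{u}} {R : Type v} : CoeFun (Cochains S R) fun _ => ∀ n : ℕ, S _⦋n⦌ → R :=
  ⟨Cochains.toFun⟩

@[ext] theorem ext {S : SSet.{u}} {R : Type v} {f g : Cochains S R}
    (h : ∀ n τ, f n τ = g n τ) : f = g := by
  cases f; cases g
  exact congrArg Cochains.mk (funext fun n => funext fun τ => h n τ)

/-- A family of cochains as a dependent function. -/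
def equivFun (S : SSet.{u}) (R : Type v) : Cochains S R ≃ (∀ n : ℕ, S _⦋n⦌ → R) :=
  ⟨Cochains.toFun, Cochains.mk, fun _ => rfl, fun _ => rfl⟩

variable {S T : SSet.{u}} {R : Type v} [Ring R]

/-- Addition of cochains is pointwise. -/
instance : AddCommGroup (Cochains S R) := (equivFun S R).addCommGroup

@[simp] theorem zero_apply (n : ℕ) (τ : S _⦋n⦌) : (0 : Cochains S R) n τ = 0 := rfl
@[simp] theorem add_apply (f g : Cochains S R) (n : ℕ) (τ : S _⦋n⦌) :
    (f + g) n τ = f n τ + g n τ := rfl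
@[simp] theorem neg_apply (f : Cochains S R) (n : ℕ) (τ : S _⦋n⦌) : (-f) n τ = -f n τ := rfl

/-- The unit: the constant `0`-cochain `1`. -/
instance : One (Cochains S R) := ⟨⟨fun n _ => if n = 0 then 1 else 0⟩⟩

/-- The cup product (Alexander-Whitney formula). -/
instance : Mul (Cochains S R) :=
  ⟨fun f g => ⟨fun n τ => ∑ pq ∈ Finset.HasAntidiagonal.antidiagonal n,
    f pq.1 (S.act (frontMap pq.1 n) τ) * g pq.2 (S.act (backMap pq.2 n) τ)⟩⟩

theorem one_apply (n : ℕ) (τ : S _⦋n⦌) :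
    (1 : Cochains S R) n τ = if n = 0 then 1 else 0 := rfl

theorem mul_apply (f g : Cochains S R) (n : ℕ) (τ : S _⦋n⦌) :
    (f * g) n τ = ∑ pq ∈ Finset.HasAntidiagonal.antidiagonal n,
      f pq.1 (S.act (frontMap pq.1 n) τ) * g pq.2 (S.act (backMap pq.2 n) τ) := rfl

theorem act_act {l m n : ℕ} (φ : ⦋l⦌ ⟶ ⦋m⦌) (θ : ⦋m⦌ ⟶ ⦋n⦌) (τ : S _⦋n⦌) :
    S.act φ (S.act θ τ) = S.act (φ ≫ θ) τ := by
  simp [SSet.act]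

theorem act_id {n : ℕ} (τ : S _⦋n⦌) : S.act (𝟙 ⦋n⦌) τ = τ := by
  simp [SSet.act]

theorem hom_ext {m n : ℕ} {φ θ : ⦋m⦌ ⟶ ⦋n⦌}
    (h : ∀ i : Fin (m + 1), (φ.toOrderHom i).1 = (θ.toOrderHom i).1) : φ = θ := by
  apply SimplexCategory.Hom.ext
  apply OrderHom.ext
  funext i
  exact Fin.ext (h i)

theorem frontMap_val (p n : ℕ) (i : Fin (p + 1)) :
    ((frontMap p n).toOrderHom i).1 = min i.1 n := rfl

theorem backMap_val (q n : ℕ) (i : Fin (q + 1)) :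
    ((backMap q n).toOrderHom i).1 = min (n - q + i.1) n := rfl

theorem comp_val {l m n : ℕ} (φ : ⦋l⦌ ⟶ ⦋m⦌) (θ : ⦋m⦌ ⟶ ⦋n⦌) (i : Fin (l + 1)) :
    ((φ ≫ θ).toOrderHom i).1 = (θ.toOrderHom (φ.toOrderHom i)).1 := rfl

theorem frontMap_self (n : ℕ) : frontMap n n = 𝟙 ⦋n⦌ :=
  hom_ext fun i => by
    rw [frontMap_val]
    exact min_eq_left (Nat.lt_succ_iff.1 i.2)

theorem backMap_self (n : ℕ) : backMap n n = 𝟙 ⦋n⦌ :=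
  hom_ext fun i => by
    rw [backMap_val, Nat.sub_self, Nat.zero_add]
    exact min_eq_left (Nat.lt_succ_iff.1 i.2)

protected theorem one_mul (f : Cochains S R) : 1 * f = f := by
  ext n τ
  rw [mul_apply, Finset.sum_eq_single (0, n)]
  · simp [one_apply, backMap_self, act_id]
  · rintro ⟨p, q⟩ hpq hne
    have hp : p ≠ 0 := by
      rintro rfl
      simp at hpq
      exact hne (by rw [hpq])
    simp [one_apply, hp]
  · simp

protected theorem mul_one (f : Cochains S R) : f * 1 = f := by
  ext n τ
  rw [mul_apply, Finset.sum_eq_single (n, 0)]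
  · simp [one_apply, frontMap_self, act_id]
  · rintro ⟨p, q⟩ hpq hne
    have hp : q ≠ 0 := by
      rintro rfl
      simp at hpq
      exact hne (by rw [hpq])
    simp [one_apply, hp]
  · simp

protected theorem mul_assoc (f g h : Cochains S R) : f * g * h = f * (g * h) := by
  ext n τ
  simp only [mul_apply, Finset.sum_mul, Finset.mul_sum, Finset.sum_sigma', act_act]
  refine Finset.sum_nbij' (fun x => ⟨(x.2.1, x.2.2 + x.1.2), (x.2.2, x.1.2)⟩)
    (fun x => ⟨(x.1.1 + x.2.1, x.2.2), (x.1.1, x.2.1)⟩) ?_ ?_ ?_ ?_ ?_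
  · rintro ⟨⟨i, j⟩, ⟨k, l⟩⟩ hx
    simp only [Finset.mem_sigma, Finset.HasAntidiagonal.mem_antidiagonal] at hx ⊢
    exact ⟨by omega, trivial⟩
  · rintro ⟨⟨i, j⟩, ⟨k, l⟩⟩ hx
    simp only [Finset.mem_sigma, Finset.HasAntidiagonal.mem_antidiagonal] at hx ⊢
    exact ⟨by omega, trivial⟩
  · rintro ⟨⟨i, j⟩, ⟨k, l⟩⟩ hx
    simp only [Finset.mem_sigma, Finset.HasAntidiagonal.mem_antidiagonal] at hx ⊢
    obtain ⟨-, rfl⟩ := hx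
    rfl
  · rintro ⟨⟨i, j⟩, ⟨k, l⟩⟩ hx
    simp only [Finset.mem_sigma, Finset.HasAntidiagonal.mem_antidiagonal] at hx ⊢
    obtain ⟨-, rfl⟩ := hx
    rfl
  · rintro ⟨⟨i, j⟩, ⟨k, l⟩⟩ hx
    simp only [Finset.mem_sigma, Finset.HasAntidiagonal.mem_antidiagonal] at hx ⊢
    obtain ⟨rfl, rfl⟩ := hx
    have e1 : frontMap k (k + l) ≫ frontMap (k + l) (k + l + j) = frontMap k (k + l + j) :=
      hom_ext fun i => by simp only [comp_val, frontMap_val]; omega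
    have e2 : backMap l (k + l) ≫ frontMap (k + l) (k + l + j)
        = frontMap l (l + j) ≫ backMap (l + j) (k + l + j) :=
      hom_ext fun i => by simp only [comp_val, frontMap_val, backMap_val]; omega
    have e3 : backMap j (l + j) ≫ backMap (l + j) (k + l + j) = backMap j (k + l + j) :=
      hom_ext fun i => by simp only [comp_val, backMap_val]; omega
    rw [e1, e2, e3, mul_assoc]

/-- The cup product makes the cochains into a ring. -/
instance : Ring (Cochains S R) :=
  { (inferInstance : AddCommGroup (Cochains S R)) with
    one := 1
    mul := (· * ·)
    one_mul := Cochains.one_mul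
    mul_one := Cochains.mul_one
    mul_assoc := Cochains.mul_assoc
    zero_mul := fun f => by
      ext n τ; simp [mul_apply]
    mul_zero := fun f => by
      ext n τ; simp [mul_apply]
    left_distrib := fun f g h => by
      ext n τ; simp [mul_apply, mul_add, Finset.sum_add_distrib]
    right_distrib := fun f g h => by
      ext n τ; simp [mul_apply, add_mul, Finset.sum_add_distrib] }

/-- The coboundary, `(d f)(τ) = ∑ i, (-1)^i f(∂_i τ)`. -/
def d (f : Cochains S R) : Cochains S R where
  toFun
    | 0, _ => 0
    | n + 1, τ => ∑ i : Fin (n + 2), (-1) ^ (i : ℕ) * f n (S.act (SimplexCategory.δ i) τ)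

theorem d_zero_apply (f : Cochains S R) (τ : S _⦋0⦌) : d f 0 τ = 0 := rfl

theorem d_succ_apply (f : Cochains S R) (n : ℕ) (τ : S _⦋n + 1⦌) :
    d f (n + 1) τ = ∑ i : Fin (n + 2), (-1) ^ (i : ℕ) * f n (S.act (SimplexCategory.δ i) τ) := rfl

theorem d_add (f g : Cochains S R) : d (f + g) = d f + d g := by
  ext n τ
  cases n with
  | zero => simp [d_zero_apply]
  | succ n => simp [d_succ_apply, mul_add, Finset.sum_add_distrib]

theorem d_zero : d (0 : Cochains S R) = 0 := by
  ext n τ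
  cases n with
  | zero => simp [d_zero_apply]
  | succ n => simp [d_succ_apply]

theorem d_neg (f : Cochains S R) : d (-f) = -d f := by
  rw [eq_neg_iff_add_eq_zero, ← d_add, neg_add_cancel, d_zero]

/-- The sign involution `f_n ↦ (-1)^n f_n`. -/
def eps (f : Cochains S R) : Cochains S R := ⟨fun n τ => (-1) ^ n * f n τ⟩

theorem eps_apply (f : Cochains S R) (n : ℕ) (τ : S _⦋n⦌) : eps f n τ = (-1) ^ n * f n τ := rfl

theorem eps_eps (f : Cochains S R) : eps (eps f) = f := by
  ext n τ
  rw [eps_apply, eps_apply, ← mul_assoc, ← pow_add, Even.neg_one_pow ⟨n, rfl⟩, one_mul]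

theorem d_eps (f : Cochains S R) : d (eps f) = -eps (d f) := by
  ext n τ
  cases n with
  | zero => simp [d_zero_apply, eps_apply]
  | succ n =>
    rw [neg_apply, eps_apply, d_succ_apply, d_succ_apply, Finset.mul_sum, ← Finset.sum_neg_distrib]
    refine Finset.sum_congr rfl fun i _ => ?_
    rw [eps_apply, ← mul_assoc, ← mul_assoc, ← pow_add, ← pow_add, pow_add, pow_add, pow_succ,
      ((Commute.refl (-1 : R)).pow_pow (i : ℕ) n).eq]
    simp

/-- The `i`-th face map, for a natural number `i`. -/
def natFace (i n : ℕ) : ⦋n⦌ ⟶ ⦋n + 1⦌ :=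
  SimplexCategory.mkHom
    ⟨fun j => ⟨if j.1 < i then j.1 else j.1 + 1, by split_ifs <;> omega⟩, fun j k h => by
      have h' : j.1 ≤ k.1 := h
      simp only [Fin.mk_le_mk]; split_ifs <;> omega⟩

theorem natFace_val (i n : ℕ) (j : Fin (n + 1)) :
    ((natFace i n).toOrderHom j).1 = if j.1 < i then j.1 else j.1 + 1 := rfl

theorem natFace_eq (n : ℕ) (i : Fin (n + 2)) : natFace (i : ℕ) n = SimplexCategory.δ i :=
  hom_ext fun j => by
    rw [natFace_val]
    change _ = (Fin.succAbove i j).1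
    rw [Fin.succAbove]
    simp only [Fin.lt_def, Fin.val_castSucc]
    split_ifs <;> rfl

theorem d_succ_eq (f : Cochains S R) (n : ℕ) (τ : S _⦋n + 1⦌) :
    d f (n + 1) τ = ∑ i ∈ Finset.range (n + 2), (-1) ^ i * f n (S.act (natFace i n) τ) := by
  rw [d_succ_apply, ← Fin.sum_univ_eq_sum_range
    (fun i => (-1) ^ i * f n (S.act (natFace i n) τ))]
  simp only [natFace_eq]

/-- The Leibniz rule. -/
theorem d_mul (f g : Cochains S R) : d (f * g) = d f * g + eps f * d g := by
  ext n τ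
  cases n with
  | zero => simp [d_zero_apply, mul_apply]
  | succ n =>
    rw [d_succ_eq, add_apply, mul_apply (d f), mul_apply (eps f), Finset.Nat.sum_antidiagonal_succ,
      Finset.Nat.sum_antidiagonal_succ']
    simp only [d_zero_apply, zero_mul, mul_zero, zero_add, mul_apply, Finset.mul_sum]
    rw [Finset.sum_comm, ← Finset.sum_add_distrib]
    refine Finset.sum_congr rfl ?_
    rintro ⟨p, q⟩ hpq
    rw [Finset.HasAntidiagonal.mem_antidiagonal] at hpq
    subst hpq
    simp only [d_succ_eq, eps_apply, act_act]
    rw [show p + q + 2 = (p + 1) + (q + 1) by omega, Finset.sum_range_add]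
    rw [Finset.sum_range_succ _ (p + 1), Finset.sum_range_succ' _ (q + 1)]
    have e1 : natFace (p + 1) p ≫ frontMap (p + 1) (p + q + 1) = frontMap p (p + q + 1) :=
      hom_ext fun i => by
        have := i.2
        simp only [comp_val, frontMap_val, natFace_val]; grind
    have e2 : natFace 0 q ≫ backMap (q + 1) (p + q + 1) = backMap q (p + q + 1) :=
      hom_ext fun i => by
        have := i.2
        simp only [comp_val, backMap_val, natFace_val]; grind
    rw [e1, e2, add_mul, mul_add, Finset.sum_mul, Finset.mul_sum]
    have s1 : ∑ i ∈ Finset.range (p + 1), (-1) ^ i * (f p (S.act (frontMap p (p + q) ≫ natFace i (p + q)) τ)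
          * g q (S.act (backMap q (p + q) ≫ natFace i (p + q)) τ))
        = ∑ i ∈ Finset.range (p + 1), (-1) ^ i * f p (S.act (natFace i p ≫ frontMap (p + 1) (p + q + 1)) τ)
          * g q (S.act (backMap q (p + q + 1)) τ) := by
      refine Finset.sum_congr rfl fun i hi => ?_
      rw [Finset.mem_range] at hi
      have a1 : frontMap p (p + q) ≫ natFace i (p + q)
          = natFace i p ≫ frontMap (p + 1) (p + q + 1) :=
        hom_ext fun j => by
          have := j.2
          simp only [comp_val, frontMap_val, natFace_val]; grind
      have a2 : backMap q (p + q) ≫ natFace i (p + q) = backMap q (p + q + 1) :=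
        hom_ext fun j => by
          have := j.2
          simp only [comp_val, backMap_val, natFace_val]; grind
      rw [a1, a2, mul_assoc]
    have s2 : ∑ i ∈ Finset.range (q + 1), (-1) ^ (p + 1 + i)
          * (f p (S.act (frontMap p (p + q) ≫ natFace (p + 1 + i) (p + q)) τ)
          * g q (S.act (backMap q (p + q) ≫ natFace (p + 1 + i) (p + q)) τ))
        = ∑ i ∈ Finset.range (q + 1), (-1) ^ p * f p (S.act (frontMap p (p + q + 1)) τ)
          * ((-1) ^ (i + 1)
            * g q (S.act (natFace (i + 1) q ≫ backMap (q + 1) (p + q + 1)) τ)) := by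
      refine Finset.sum_congr rfl fun i hi => ?_
      rw [Finset.mem_range] at hi
      have a1 : frontMap p (p + q) ≫ natFace (p + 1 + i) (p + q) = frontMap p (p + q + 1) :=
        hom_ext fun j => by
          have := j.2
          simp only [comp_val, frontMap_val, natFace_val]; grind
      have a2 : backMap q (p + q) ≫ natFace (p + 1 + i) (p + q)
          = natFace (i + 1) q ≫ backMap (q + 1) (p + q + 1) :=
        hom_ext fun j => by
          have := j.2
          simp only [comp_val, backMap_val, natFace_val]; grind
      have c : ∀ (k : ℕ) (x : R), Commute ((-1 : R) ^ k) x :=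
        fun k x => ((Commute.neg_one_left x).pow_left k)
      rw [a1, a2, show p + 1 + i = p + (i + 1) by omega, pow_add]
      rw [mul_assoc ((-1 : R) ^ p), mul_assoc ((-1 : R) ^ p), ← mul_assoc ((-1 : R) ^ (i + 1)),
        (c (i + 1) _).eq, mul_assoc]
    rw [s1, s2]
    simp only [pow_zero, one_mul, pow_succ]
    noncomm_ring

/-- The ring map on cochains given by a map of simplicial sets. -/
def comap (φ : S ⟶ T) : Cochains T R →+* Cochains S R where
  toFun f := ⟨fun n τ => f n (φ.app _ τ)⟩
  map_one' := rfl
  map_zero' := rfl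
  map_add' _ _ := rfl
  map_mul' f g := by
    ext n τ
    simp only [mul_apply, SSet.act, NatTrans.naturality_apply]

theorem comap_d (φ : S ⟶ T) (f : Cochains T R) :
    comap φ (d f) = d (comap φ f) := by
  ext n τ
  cases n with
  | zero => rfl
  | succ n =>
    change d f (n + 1) _ = _
    rw [d_succ_apply, d_succ_apply]
    refine Finset.sum_congr rfl fun i _ => ?_
    change _ = _ * f n _
    simp only [SSet.act, NatTrans.naturality_apply]

/-- A family of cochains is bounded if only finitely many of its terms are nonzero: the bounded
families form the direct sum of the cochain groups. -/
def IsBounded (f : Cochains S R) : Prop := ∃ N : ℕ, ∀ n, N ≤ n → ∀ τ, f n τ = 0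

theorem IsBounded.mul {f g : Cochains S R} (hf : IsBounded f) (hg : IsBounded g) :
    IsBounded (f * g) := by
  obtain ⟨M, hM⟩ := hf
  obtain ⟨N, hN⟩ := hg
  refine ⟨M + N, fun n hn τ => ?_⟩
  rw [mul_apply]
  refine Finset.sum_eq_zero ?_
  rintro ⟨p, q⟩ hpq
  rw [Finset.HasAntidiagonal.mem_antidiagonal] at hpq
  dsimp only at hpq ⊢
  by_cases hp : M ≤ p
  · rw [hM p hp, zero_mul]
  · rw [hN q (by omega), mul_zero]

theorem IsBounded.add {f g : Cochains S R} (hf : IsBounded f) (hg : IsBounded g) :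
    IsBounded (f + g) := by
  obtain ⟨M, hM⟩ := hf
  obtain ⟨N, hN⟩ := hg
  refine ⟨M + N, fun n hn τ => ?_⟩
  rw [add_apply, hM n (by omega), hN n (by omega), add_zero]

theorem IsBounded.neg {f : Cochains S R} (hf : IsBounded f) : IsBounded (-f) := by
  obtain ⟨M, hM⟩ := hf
  exact ⟨M, fun n hn τ => by rw [neg_apply, hM n hn, neg_zero]⟩

theorem IsBounded.eps {f : Cochains S R} (hf : IsBounded f) : IsBounded (eps f) := by
  obtain ⟨M, hM⟩ := hf
  exact ⟨M, fun n hn τ => by rw [eps_apply, hM n hn, mul_zero]⟩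

theorem isBounded_zero : IsBounded (0 : Cochains S R) := ⟨0, fun _ _ _ => rfl⟩

theorem isBounded_one : IsBounded (1 : Cochains S R) :=
  ⟨1, fun n hn τ => by rw [one_apply, if_neg (by omega)]⟩

theorem d_one : d (1 : Cochains S R) = 0 := by
  have h := d_mul (1 : Cochains S R) 1
  have h' : Cochains.eps (1 : Cochains S R) = 1 := by
    ext n τ
    rw [eps_apply, one_apply]
    split_ifs with hn <;> simp [hn]
  rw [h', one_mul, one_mul, mul_one] at h
  simpa using h

variable (S R) in
/-- The ring of cocycles in the direct sum of the cochain groups. -/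
def cocycles : Subring (Cochains S R) where
  carrier := {f | IsBounded f ∧ d f = 0}
  one_mem' := ⟨isBounded_one, d_one⟩
  zero_mem' := ⟨isBounded_zero, d_zero⟩
  mul_mem' := fun hf hg => ⟨hf.1.mul hg.1, by rw [d_mul, hf.2, hg.2, zero_mul, mul_zero, add_zero]⟩
  add_mem' := fun hf hg => ⟨hf.1.add hg.1, by rw [d_add, hf.2, hg.2, add_zero]⟩
  neg_mem' := fun hf => ⟨hf.1.neg, by rw [d_neg, hf.2, neg_zero]⟩

variable (S R) in
/-- The ideal of coboundaries in the ring of cocycles. -/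
def coboundaries : Ideal (cocycles S R) where
  carrier := {z | ∃ c : Cochains S R, IsBounded c ∧ d c = z}
  zero_mem' := ⟨0, isBounded_zero, d_zero⟩
  add_mem' := by
    rintro x y ⟨a, ha, hax⟩ ⟨b, hb, hby⟩
    exact ⟨a + b, ha.add hb, by rw [d_add, hax, hby]; rfl⟩
  smul_mem' := by
    rintro z x ⟨a, ha, hax⟩
    refine ⟨eps z.1 * a, z.2.1.eps.mul ha, ?_⟩
    have hz : d (eps z.1) = 0 := by
      rw [d_eps, z.2.2]
      ext n τ
      simp [eps_apply]
    rw [d_mul, hz, zero_mul, zero_add, eps_eps, hax]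
    rfl

instance : (coboundaries S R).IsTwoSided :=
  ⟨by
    rintro x z ⟨a, ha, hax⟩
    refine ⟨a * z.1, ha.mul z.2.1, ?_⟩
    rw [d_mul, z.2.2, mul_zero, add_zero, hax]
    rfl⟩

theorem IsBounded.comap (φ : S ⟶ T) {f : Cochains T R} (hf : IsBounded f) :
    IsBounded (comap φ f) := by
  obtain ⟨M, hM⟩ := hf
  exact ⟨M, fun n hn τ => hM n hn _⟩

/-- The map induced on cocycles. -/
def cocyclesMap (φ : S ⟶ T) : cocycles T R →+* cocycles S R :=
  ((Cochains.comap φ).comp (cocycles T R).subtype).codRestrict (cocycles S R) fun z =>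
    ⟨z.2.1.comap φ, by
      change d (Cochains.comap φ z.1) = 0
      rw [← comap_d, z.2.2, map_zero]⟩

theorem coboundaries_le_comap (φ : S ⟶ T) :
    coboundaries T R ≤ (coboundaries S R).comap (cocyclesMap φ) := by
  rintro z ⟨c, hc, hcz⟩
  refine ⟨Cochains.comap φ c, hc.comap φ, ?_⟩
  rw [← comap_d, hcz]
  rfl

end Cochains

section Cohomology

variable (R : Type v) [Ring R]

/-- The singular cohomology ring `H^*(X; R) = ⨁ n, H^n(X; R)` of a topological space, with the
cup product: the cohomology of the direct sum of the groups of singular cochains. -/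
abbrev SingularCohomology (X : Type u) [TopologicalSpace X] : Type (max u v) :=
  Cochains.cocycles (TopCat.toSSet.obj (TopCat.of X)) R ⧸
    Cochains.coboundaries (TopCat.toSSet.obj (TopCat.of X)) R

/-- The ring homomorphism `f^* : H^*(Y; R) → H^*(X; R)` induced by a continuous map. -/
noncomputable def SingularCohomology.map {X Y : Type u} [TopologicalSpace X] [TopologicalSpace Y]
    (f : C(X, Y)) : SingularCohomology R Y →+* SingularCohomology R X :=
  Ideal.quotientMap _ (Cochains.cocyclesMap (TopCat.toSSet.map (TopCat.ofHom f)))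
    (Cochains.coboundaries_le_comap _)

/-- The reduced cohomology of a based space: the kernel of the restriction to the base point. -/
noncomputable def reducedCohomology (Y : Type u) [TopologicalSpace Y] (y : Y) :
    Ideal (SingularCohomology R Y) :=
  RingHom.ker (SingularCohomology.map R (ContinuousMap.const PUnit.{u + 1} y))

/-- The diagonal inclusion `X → X × X`. -/
def diagonalMap (X : Type u) [TopologicalSpace X] : C(X, X × X) := ⟨fun x => (x, x), by fun_prop⟩

/-- The ideal of zero-divisors: the kernel of `Δ^* : H^*(X × X; R) → H^*(X; R)`. -/
noncomputable def zeroDivisorIdeal (X : Type u) [TopologicalSpace X] :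
    Ideal (SingularCohomology R (X × X)) :=
  RingHom.ker (SingularCohomology.map R (diagonalMap X))

/-- The zero-divisors cup-length: the supremum of the numbers `k` such that some product of `k`
zero-divisors is nonzero. -/
noncomputable def zeroDivisorsCupLength (X : Type u) [TopologicalSpace X] : ℕ∞ :=
  ⨆ (k : ℕ) (_ : ∃ u : Fin k → SingularCohomology R (X × X),
    (∀ i, u i ∈ zeroDivisorIdeal R X) ∧ (List.ofFn u).prod ≠ 0), (k : ℕ∞)

end Cohomology

end SimplicialCochains

/-!
The theorem is proved with explicit singular cochains, and it rests on two facts.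

*Homotopy invariance* (`Cochains.isCoboundary_pull_sub`) follows from Mathlib's prism operator on
simplicial chains, by evaluating cochains on it.

*Small simplices* (`Cochains.exists_d_eq_of_pull_subspaceIncl`): for an open cover of a space, a
cocycle that vanishes on every simplex contained in some member of the cover is the coboundary of a
cochain with the same property. Barycentric subdivision `sd` and the homotopy `sdHomotopy` from it
to the identity are defined on affine chains by coning off barycenters, and they are carried to
cochains by duality. If `c` is such a cocycle, then `sdᵐ c` vanishes on a given simplex `σ` for all
large `m`, since the pieces of an iterated subdivision shrink below a Lebesgue number. So the sum of
the terms `sdⁱ (sdHomotopy c)` is finite on each `σ`, and its coboundary telescopes to `c`.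

For a map `f : A → B` with a left inverse, the mapping cone is the union of two open sets: a lower
part that retracts to `B`, and an upper part that contracts to the cone point, with intersection
homotopy equivalent to `A` (`MappingCone.coneDecomposition`). Since the restriction along `f` is
surjective in cohomology, a Mayer-Vietoris argument shows that the reduced cohomology of the cone is
mapped bijectively onto the kernel of this restriction (`ConeDecomposition.injOn`,
`ConeDecomposition.surjOn`). Here cochains on the two parts are glued by extending them by zero, and
the failure of the glued cochain to be correct on large simplices is repaired by small simplices.
The diagonal of `X` has the first projection as a left inverse.

For the bound on the cup-length, let `n + 1` open sets carry homotopy sections of the evaluation of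
based paths. Their inclusions are null-homotopic, so the `i`-th of `n + 1` reduced classes has a
representative that vanishes on the `i`-th set. The product of these representatives vanishes on all
small simplices, so it is a coboundary (`prod_eq_zero_of_cover`). Every product of zero-divisors is
the image of a product of reduced classes of the cone.
-/

/-! ### Singular simplices and pullback of cochains -/

section SingularSimplices

open CategoryTheory
open scoped Simplicial

variable {X Y Z : Type u} [TopologicalSpace X] [TopologicalSpace Y] [TopologicalSpace Z]

/-- The singular simplicial set of a topological space. -/
noncomputable abbrev singularSet (X : Type u) [TopologicalSpace X] : SSet.{u} :=
  TopCat.toSSet.obj (TopCat.of X)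

/-- The map of singular simplicial sets induced by a continuous map. -/
noncomputable abbrev singularSetMap (f : C(X, Y)) : singularSet X ⟶ singularSet Y :=
  TopCat.toSSet.map (TopCat.ofHom f)

/-- Singular `n`-simplices are the continuous maps from the standard simplex. -/
noncomputable def simplexEquiv (X : Type u) [TopologicalSpace X] (n : ℕ) :
    singularSet X _⦋n⦌ ≃ C(stdSimplex ℝ (Fin (n + 1)), X) :=
  TopCat.toSSetObjEquiv (TopCat.of X) (Opposite.op ⦋n⦌)

theorem simplexEquiv_act {m n : ℕ} (θ : ⦋m⦌ ⟶ ⦋n⦌) (τ : singularSet X _⦋n⦌) :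
    simplexEquiv X m (SSet.act _ θ τ) =
      (simplexEquiv X n τ).comp ⟨_, stdSimplex.continuous_map θ.toOrderHom⟩ := rfl

theorem simplexEquiv_map (f : C(X, Y)) {n : ℕ} (τ : singularSet X _⦋n⦌) :
    simplexEquiv Y n ((singularSetMap f).app _ τ) = f.comp (simplexEquiv X n τ) := rfl

theorem act_simplexEquiv_symm {m n : ℕ} (θ : ⦋m⦌ ⟶ ⦋n⦌) (φ : C(stdSimplex ℝ (Fin (n + 1)), X)) :
    SSet.act _ θ ((simplexEquiv X n).symm φ) =
      (simplexEquiv X m).symm (φ.comp ⟨_, stdSimplex.continuous_map θ.toOrderHom⟩) := by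
  apply (simplexEquiv X m).injective
  rw [simplexEquiv_act, Equiv.apply_symm_apply, Equiv.apply_symm_apply]

theorem map_simplexEquiv_symm (f : C(X, Y)) {n : ℕ} (φ : C(stdSimplex ℝ (Fin (n + 1)), X)) :
    (singularSetMap f).app _ ((simplexEquiv X n).symm φ) =
      (simplexEquiv Y n).symm (f.comp φ) := by
  apply (simplexEquiv Y n).injective
  rw [simplexEquiv_map, Equiv.apply_symm_apply, Equiv.apply_symm_apply]

variable {R : Type v} [Ring R]

namespace Cochains

/-- The pullback of singular cochains along a continuous map. -/
noncomputable def pull (f : C(X, Y)) : Cochains (singularSet Y) R →+* Cochains (singularSet X) R :=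
  comap (singularSetMap f)

theorem pull_apply (f : C(X, Y)) (c : Cochains (singularSet Y) R) (n : ℕ)
    (τ : singularSet X _⦋n⦌) : pull f c n τ = c n ((singularSetMap f).app _ τ) := rfl

theorem pull_d (f : C(X, Y)) (c : Cochains (singularSet Y) R) : pull f (d c) = d (pull f c) :=
  comap_d _ _

theorem pull_comp (g : C(Y, Z)) (f : C(X, Y)) (c : Cochains (singularSet Z) R) :
    pull (g.comp f) c = pull f (pull g c) := rfl

theorem pull_id (c : Cochains (singularSet X) R) : pull (ContinuousMap.id X) c = c := rfl

theorem IsBounded.pull (f : C(X, Y)) {c : Cochains (singularSet Y) R} (hc : IsBounded c) :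
    IsBounded (pull f c) := hc.comap _

theorem IsBounded.sub {S : SSet.{u}} {f g : Cochains S R} (hf : IsBounded f) (hg : IsBounded g) :
    IsBounded (f - g) := sub_eq_add_neg f g ▸ hf.add hg.neg

theorem d_sub {S : SSet.{u}} (f g : Cochains S R) : d (f - g) = d f - d g := by
  rw [sub_eq_add_neg, d_add, d_neg, ← sub_eq_add_neg]

theorem sub_apply {S : SSet.{u}} (f g : Cochains S R) (n : ℕ) (τ : S _⦋n⦌) :
    (f - g) n τ = f n τ - g n τ := by
  rw [sub_eq_add_neg, add_apply, neg_apply, ← sub_eq_add_neg]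

/-- Being the coboundary of a bounded cochain. -/
def IsCoboundary {S : SSet.{u}} (c : Cochains S R) : Prop := ∃ b, IsBounded b ∧ d b = c

end Cochains
end SingularSimplices

/-! ### Affine chains and their barycentric subdivision -/

section AffineChains

/-- The augmented group of ordered affine chains: the free abelian group on the lists of `n`
vertices in `K`, the empty list included. A list of `n + 1` vertices stands for an `n`-simplex. -/
abbrev AffineChain (n : ℕ) (K : Type u) : Type u := FreeAbelianGroup (Fin n → K)

namespace AffineChain

open FreeAbelianGroup (of lift)

variable {K L : Type u} {n : ℕ}

/-- The boundary of affine chains, which maps each vertex to the empty list. -/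
noncomputable def boundary (n : ℕ) : AffineChain (n + 1) K →+ AffineChain n K :=
  lift fun v => ∑ i : Fin (n + 1), (-1 : ℤ) ^ (i : ℕ) • of (v ∘ i.succAbove)

theorem boundary_of (v : Fin (n + 1) → K) :
    boundary n (of v) = ∑ i : Fin (n + 1), (-1 : ℤ) ^ (i : ℕ) • of (v ∘ i.succAbove) :=
  FreeAbelianGroup.lift_apply_of _ _

/-- The cone with apex `b` on an affine chain. -/
noncomputable def cone (b : K) : AffineChain n K →+ AffineChain (n + 1) K :=
  FreeAbelianGroup.map fun v => (Fin.cons b v : Fin (n + 1) → K)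

theorem cone_of (b : K) (v : Fin n → K) :
    cone b (of v) = of (Fin.cons b v : Fin (n + 1) → K) :=
  FreeAbelianGroup.map_of_apply _

/-- The map of affine chains induced by a map of vertices. -/
noncomputable def map (α : K → L) : AffineChain n K →+ AffineChain n L :=
  FreeAbelianGroup.map fun v => α ∘ v

theorem map_of (α : K → L) (v : Fin n → K) : map α (of v) = of (α ∘ v) :=
  FreeAbelianGroup.map_of_apply _

theorem map_cone (α : K → L) (b : K) (x : AffineChain n K) :
    map α (cone b x) = cone (α b) (map α x) := by
  refine DFunLike.congr_fun (f := (map α).comp (cone b)) (g := (cone (α b)).comp (map α))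
    (FreeAbelianGroup.lift_ext _ _ fun v => ?_) x
  simp only [AddMonoidHom.comp_apply, cone_of, map_of]
  congr 1
  ext i
  cases i using Fin.cases <;> simp

theorem map_boundary (α : K → L) (x : AffineChain (n + 1) K) :
    map α (boundary n x) = boundary n (map α x) := by
  refine DFunLike.congr_fun (f := (map α).comp (boundary n)) (g := (boundary n).comp (map α))
    (FreeAbelianGroup.lift_ext _ _ fun v => ?_) x
  simp only [AddMonoidHom.comp_apply, boundary_of, map_of, map_sum, map_zsmul,
    Function.comp_assoc]

theorem boundary_cone (b : K) (x : AffineChain (n + 1) K) :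
    boundary (n + 1) (cone b x) = x - cone b (boundary n x) := by
  refine DFunLike.congr_fun (f := (boundary (n + 1)).comp (cone b))
    (g := AddMonoidHom.id _ - (cone b).comp (boundary n))
    (FreeAbelianGroup.lift_ext _ _ fun v => ?_) x
  simp only [AddMonoidHom.comp_apply, AddMonoidHom.sub_apply, AddMonoidHom.id_apply, cone_of,
    boundary_of, map_sum, map_zsmul]
  rw [Fin.sum_univ_succ, sub_eq_add_neg, ← Finset.sum_neg_distrib]
  congr 1
  refine Finset.sum_congr rfl fun i _ => ?_
  rw [Fin.val_succ, pow_succ, mul_neg, mul_one, neg_smul]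
  congr 3
  ext j
  cases j using Fin.cases <;> simp

theorem boundary_cone_zero (b : K) (x : AffineChain 0 K) : boundary 0 (cone b x) = x := by
  refine DFunLike.congr_fun (f := (boundary 0).comp (cone b)) (g := AddMonoidHom.id _)
    (FreeAbelianGroup.lift_ext _ _ fun v => ?_) x
  simp only [AddMonoidHom.comp_apply, AddMonoidHom.id_apply, cone_of, boundary_of]
  simp only [Fin.sum_univ_succ, Fin.val_zero, pow_zero, one_smul, Finset.univ_eq_empty,
    Finset.sum_empty, add_zero]
  congr 1

theorem of_eq_cone (v : Fin (n + 1) → K) : of v = cone (v 0) (of (Fin.tail v)) := by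
  rw [cone_of, Fin.cons_self_tail]

theorem boundary_boundary (x : AffineChain (n + 2) K) :
    boundary n (boundary (n + 1) x) = 0 := by
  refine DFunLike.congr_fun (f := (boundary n).comp (boundary (n + 1))) (g := 0)
    (FreeAbelianGroup.lift_ext _ _ fun v => ?_) x
  simp only [AddMonoidHom.comp_apply, AddMonoidHom.zero_apply]
  clear x
  rw [of_eq_cone, boundary_cone, map_sub]
  induction n with
  | zero => rw [boundary_cone_zero, sub_self]
  | succ n ih =>
    rw [boundary_cone, of_eq_cone (Fin.tail v), boundary_cone, map_sub, ih]
    simp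

/-- Barycentric subdivision, with respect to any choice `b` of a point for each nonempty list of
vertices: the cone from that point on the subdivision of the boundary. -/
noncomputable def subdivision (b : ∀ n, (Fin (n + 1) → K) → K) :
    ∀ n, AffineChain n K →+ AffineChain n K
  | 0 => AddMonoidHom.id _
  | n + 1 => lift fun v => cone (b n v) (subdivision b n (boundary n (of v)))

/-- The natural chain homotopy between the identity and barycentric subdivision. -/
noncomputable def subdivisionHomotopy (b : ∀ n, (Fin (n + 1) → K) → K) :
    ∀ n, AffineChain n K →+ AffineChain (n + 1) K
  | 0 => 0
  | n + 1 => lift fun v => cone (b n v) (of v - subdivisionHomotopy b n (boundary n (of v)))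

variable (b : ∀ n, (Fin (n + 1) → K) → K)

theorem subdivision_of (v : Fin (n + 1) → K) :
    subdivision b (n + 1) (of v) = cone (b n v) (subdivision b n (boundary n (of v))) :=
  FreeAbelianGroup.lift_apply_of _ _

theorem subdivisionHomotopy_of (v : Fin (n + 1) → K) :
    subdivisionHomotopy b (n + 1) (of v) =
      cone (b n v) (of v - subdivisionHomotopy b n (boundary n (of v))) :=
  FreeAbelianGroup.lift_apply_of _ _

theorem boundary_subdivision (x : AffineChain (n + 1) K) :
    boundary n (subdivision b (n + 1) x) = subdivision b n (boundary n x) := by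
  refine DFunLike.congr_fun (f := (boundary n).comp (subdivision b (n + 1)))
    (g := (subdivision b n).comp (boundary n)) (FreeAbelianGroup.lift_ext _ _ fun v => ?_) x
  simp only [AddMonoidHom.comp_apply, subdivision_of]
  clear x
  induction n with
  | zero => rw [boundary_cone_zero]
  | succ n ih =>
    have ih' : ∀ y : AffineChain (n + 1) K,
        boundary n (subdivision b (n + 1) y) = subdivision b n (boundary n y) := fun y =>
      DFunLike.congr_fun (f := (boundary n).comp (subdivision b (n + 1)))
        (g := (subdivision b n).comp (boundary n))
        (FreeAbelianGroup.lift_ext _ _ fun v => by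
          simpa only [AddMonoidHom.comp_apply, subdivision_of] using ih v) y
    rw [boundary_cone, ih', boundary_boundary, map_zero, map_zero, sub_zero]

theorem boundary_subdivisionHomotopy (x : AffineChain (n + 1) K) :
    boundary (n + 1) (subdivisionHomotopy b (n + 1) x) + subdivisionHomotopy b n (boundary n x) =
      x - subdivision b (n + 1) x := by
  induction n with
  | zero =>
    refine DFunLike.congr_fun (f := (boundary 1).comp (subdivisionHomotopy b 1) +
        (subdivisionHomotopy b 0).comp (boundary 0))
      (g := AddMonoidHom.id _ - subdivision b 1)
      (FreeAbelianGroup.lift_ext _ _ fun v => ?_) x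
    simp only [AddMonoidHom.comp_apply, AddMonoidHom.add_apply, AddMonoidHom.sub_apply,
      AddMonoidHom.id_apply, subdivision_of, subdivisionHomotopy_of]
    simp [subdivision, subdivisionHomotopy, boundary_cone]
  | succ n ih =>
    refine DFunLike.congr_fun (f := (boundary (n + 2)).comp (subdivisionHomotopy b (n + 2)) +
        (subdivisionHomotopy b (n + 1)).comp (boundary (n + 1)))
      (g := AddMonoidHom.id _ - subdivision b (n + 2))
      (FreeAbelianGroup.lift_ext _ _ fun v => ?_) x
    simp only [AddMonoidHom.comp_apply, AddMonoidHom.add_apply, AddMonoidHom.sub_apply,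
      AddMonoidHom.id_apply]
    have h := ih (boundary (n + 1) (of v))
    rw [boundary_boundary, map_zero, add_zero] at h
    rw [subdivision_of, subdivisionHomotopy_of, boundary_cone, map_sub (boundary (n + 1)), h,
      sub_sub_cancel]
    abel

section Naturality

variable {b} {b' : ∀ n, (Fin (n + 1) → L) → L} {α : K → L}

theorem map_subdivision (hα : ∀ n (v : Fin (n + 1) → K), α (b n v) = b' n (α ∘ v))
    (x : AffineChain n K) :
    map α (subdivision b n x) = subdivision b' n (map α x) := by
  induction n with
  | zero => rfl
  | succ n ih =>
    refine DFunLike.congr_fun (f := (map α).comp (subdivision b (n + 1)))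
      (g := (subdivision b' (n + 1)).comp (map α)) (FreeAbelianGroup.lift_ext _ _ fun v => ?_) x
    simp only [AddMonoidHom.comp_apply, subdivision_of, map_of, map_cone, ih, map_boundary, hα]

theorem map_subdivisionHomotopy (hα : ∀ n (v : Fin (n + 1) → K), α (b n v) = b' n (α ∘ v))
    (x : AffineChain n K) :
    map α (subdivisionHomotopy b n x) = subdivisionHomotopy b' n (map α x) := by
  induction n with
  | zero => simp [subdivisionHomotopy]
  | succ n ih =>
    refine DFunLike.congr_fun (f := (map α).comp (subdivisionHomotopy b (n + 1)))
      (g := (subdivisionHomotopy b' (n + 1)).comp (map α))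
      (FreeAbelianGroup.lift_ext _ _ fun v => ?_) x
    simp only [AddMonoidHom.comp_apply, subdivisionHomotopy_of, map_of, map_cone, map_sub, ih,
      map_boundary, hα]

end Naturality

/-- The chains all of whose terms satisfy `P`. -/
def chainsIn (P : (Fin n → K) → Prop) : AddSubgroup (AffineChain n K) :=
  AddSubgroup.closure (of '' {v | P v})

theorem of_mem_chainsIn {P : (Fin n → K) → Prop} {v : Fin n → K} (h : P v) :
    of v ∈ chainsIn P := AddSubgroup.subset_closure ⟨v, h, rfl⟩

theorem apply_mem_of_mem_chainsIn {G : Type v} [AddCommGroup G] {P : (Fin n → K) → Prop}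
    {H : AddSubgroup G} (f : AffineChain n K →+ G) (hf : ∀ v, P v → f (of v) ∈ H)
    {x : AffineChain n K} (hx : x ∈ chainsIn P) : f x ∈ H := by
  have : chainsIn P ≤ H.comap f := (AddSubgroup.closure_le _).2 <| by
    rintro _ ⟨v, hv, rfl⟩
    exact hf v hv
  exact this hx

end AffineChain

end AffineChains

/-! ### Affine simplices in a standard simplex -/

section AffineSimplices

open FreeAbelianGroup (of lift)

/-- The standard topological `n`-simplex. -/
abbrev TopSimplex (n : ℕ) : Type := stdSimplex ℝ (Fin (n + 1))

/-- The affine singular simplex of a standard simplex with given vertices. -/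
def affineSimplex {k m : ℕ} (v : Fin (k + 1) → TopSimplex m) : C(TopSimplex k, TopSimplex m) where
  toFun t := ⟨∑ i, t.1 i • (v i).1, (convex_stdSimplex ℝ _).sum_mem (fun i _ => t.2.1 i) t.2.2
    fun i _ => (v i).2⟩
  continuous_toFun := by
    refine Continuous.subtype_mk (continuous_finsetSum _ fun i _ => ?_) _
    exact ((continuous_apply i).comp continuous_subtype_val).smul continuous_const

theorem affineSimplex_val {k m : ℕ} (v : Fin (k + 1) → TopSimplex m) (t : TopSimplex k) :
    (affineSimplex v t).1 = ∑ i, t.1 i • (v i).1 := rfl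

theorem affineSimplex_comp {k l m : ℕ} (w : Fin (l + 1) → TopSimplex m)
    (v : Fin (k + 1) → TopSimplex l) :
    (affineSimplex w).comp (affineSimplex v) = affineSimplex (affineSimplex w ∘ v) := by
  ext t : 1
  apply Subtype.ext
  simp only [ContinuousMap.comp_apply, affineSimplex_val, Function.comp_apply, Finset.sum_apply,
    Pi.smul_apply, Finset.smul_sum, Finset.sum_smul, smul_smul, smul_eq_mul]
  exact Finset.sum_comm

/-- The list of vertices of the standard simplex. -/
def stdVertices (n : ℕ) : Fin (n + 1) → TopSimplex n := fun i => stdSimplex.vertex i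

theorem affineSimplex_vertices {k m : ℕ} (v : Fin (k + 1) → TopSimplex m) :
    affineSimplex v ∘ stdVertices k = v := by
  ext i : 1
  apply Subtype.ext
  simp [affineSimplex_val, stdVertices, Pi.single_apply]

theorem affineSimplex_stdVertices (n : ℕ) : affineSimplex (stdVertices n) = ContinuousMap.id _ := by
  ext t : 1
  apply Subtype.ext
  funext j
  simp [affineSimplex_val, stdVertices, Pi.single_apply, Finset.sum_apply]

theorem stdSimplex_map_eq_affineSimplex {m n : ℕ} (θ : Fin (m + 1) → Fin (n + 1)) :
    (⟨_, stdSimplex.continuous_map θ⟩ : C(TopSimplex m, TopSimplex n)) =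
      affineSimplex (stdVertices n ∘ θ) := by
  ext t : 1
  apply Subtype.ext
  funext j
  change FunOnFinite.linearMap ℝ ℝ θ t.1 j = _
  rw [FunOnFinite.linearMap_apply_apply, affineSimplex_val, Finset.sum_apply, Finset.sum_filter]
  refine Finset.sum_congr rfl fun i _ => ?_
  simp [stdVertices, Pi.single_apply, eq_comm]

theorem affineSimplex_comp_face {k m : ℕ} (v : Fin (k + 2) → TopSimplex m) (i : Fin (k + 2)) :
    (affineSimplex v).comp ⟨_, stdSimplex.continuous_map i.succAbove⟩ =
      affineSimplex (v ∘ i.succAbove) := by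
  rw [stdSimplex_map_eq_affineSimplex, affineSimplex_comp, ← Function.comp_assoc,
    affineSimplex_vertices]

/-- The barycenter of a nonempty list of points of a standard simplex. -/
noncomputable def listBarycenter (m n : ℕ) (v : Fin (n + 1) → TopSimplex m) : TopSimplex m :=
  affineSimplex v stdSimplex.barycenter

theorem affineSimplex_listBarycenter {l m n : ℕ} (w : Fin (l + 1) → TopSimplex m)
    (v : Fin (n + 1) → TopSimplex l) :
    affineSimplex w (listBarycenter l n v) = listBarycenter m n (affineSimplex w ∘ v) := by
  rw [listBarycenter, listBarycenter, ← affineSimplex_comp]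
  rfl

/-! ### The size of the simplices of an iterated subdivision -/

theorem dist_affineSimplex_le {k m : ℕ} {v : Fin (k + 1) → TopSimplex m} {x : TopSimplex m}
    {r : ℝ} (h : ∀ i, dist (v i) x ≤ r) (t : TopSimplex k) : dist (affineSimplex v t) x ≤ r := by
  have : (affineSimplex v t).1 ∈ Metric.closedBall x.1 r :=
    (convex_closedBall x.1 r).sum_mem (fun i _ => t.2.1 i) t.2.2 fun i _ => h i
  exact this

theorem dist_listBarycenter_le {m n : ℕ} {v : Fin (n + 1) → TopSimplex m} {D : ℝ}
    (h : ∀ i j, dist (v i) (v j) ≤ D) (j : Fin (n + 1)) :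
    dist (listBarycenter m n v) (v j) ≤ n / (n + 1) * D := by
  have e : (listBarycenter m n v).1 - (v j).1 =
      ((n : ℝ) + 1)⁻¹ • ∑ i, ((v i).1 - (v j).1) := by
    have h1 : ((n : ℝ) + 1) ≠ 0 := by positivity
    rw [listBarycenter, affineSimplex_val, Finset.sum_sub_distrib, smul_sub, Finset.smul_sum]
    simp only [stdSimplex.barycenter_apply, Fintype.card_fin, Finset.sum_const, Finset.card_univ,
      Nat.cast_add, Nat.cast_one]
    rw [← Nat.cast_smul_eq_nsmul ℝ, smul_smul, Nat.cast_add, Nat.cast_one, inv_mul_cancel₀ h1,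
      one_smul]
  have h2 : ‖∑ i, ((v i).1 - (v j).1)‖ ≤ n * D := by
    rw [← Finset.sum_erase Finset.univ (f := fun i => (v i).1 - (v j).1) (a := j) (sub_self _)]
    refine (norm_sum_le_of_le (n := fun _ => D) _ fun i _ => ?_).trans_eq ?_
    · rw [← dist_eq_norm]; exact h i j
    · simp
  rw [Subtype.dist_eq, dist_eq_norm, e, norm_smul, norm_inv, Real.norm_of_nonneg (by positivity)]
  calc ((n : ℝ) + 1)⁻¹ * ‖∑ i, ((v i).1 - (v j).1)‖ ≤ ((n : ℝ) + 1)⁻¹ * (n * D) := by gcongr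
    _ = n / (n + 1) * D := by ring

namespace AffineChain

/-- Barycentric subdivision of the affine chains in a standard simplex. -/
noncomputable abbrev sd (m n : ℕ) : AffineChain n (TopSimplex m) →+ AffineChain n (TopSimplex m) :=
  subdivision (listBarycenter m) n

/-- The chain homotopy between the identity and barycentric subdivision in a standard simplex. -/
noncomputable abbrev sdHomotopy (m n : ℕ) :
    AffineChain n (TopSimplex m) →+ AffineChain (n + 1) (TopSimplex m) :=
  subdivisionHomotopy (listBarycenter m) n

/-- The terms of the subdivision of `w` lie in every ball that contains `w`, and their diameter is
smaller by a factor that depends only on the dimension. -/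
theorem sd_of_mem_chainsIn {m N n : ℕ} (hn : n ≤ N + 1) {D : ℝ} (hD : 0 ≤ D)
    (w : Fin n → TopSimplex m) (hw : ∀ i j, dist (w i) (w j) ≤ D) :
    sd m n (of w) ∈ chainsIn fun v : Fin n → TopSimplex m =>
      (∀ x r, (∀ j, dist (w j) x ≤ r) → ∀ i, dist (v i) x ≤ r) ∧
      ∀ i j, dist (v i) (v j) ≤ N / (N + 1) * D := by
  induction n with
  | zero => exact of_mem_chainsIn ⟨fun x r _ i => i.elim0, fun i => i.elim0⟩
  | succ n ih =>
    rw [sd, subdivision_of, boundary_of, map_sum, map_sum]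
    refine sum_mem fun i _ => ?_
    rw [map_zsmul, map_zsmul]
    refine zsmul_mem ?_ _
    refine apply_mem_of_mem_chainsIn _ ?_ (ih (by omega) (w ∘ i.succAbove) fun _ _ => hw _ _)
    rintro v ⟨hv1, hv2⟩
    rw [cone_of]
    refine of_mem_chainsIn ?_
    -- The distance from the barycenter to a point of the subdivided face.
    have hb : ∀ j, dist (listBarycenter m n w) (v j) ≤ N / (N + 1) * D := fun j => by
      rw [dist_comm]
      refine hv1 _ _ (fun j => ?_) j
      rw [dist_comm]
      refine (dist_listBarycenter_le hw _).trans (mul_le_mul_of_nonneg_right ?_ hD)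
      have : (n : ℝ) ≤ N := by exact_mod_cast Nat.lt_succ_iff.1 hn
      rw [div_le_div_iff₀ (by positivity) (by positivity)]
      nlinarith
    refine ⟨fun x r hx j => ?_, fun j k => ?_⟩
    · cases j using Fin.cases with
      | zero => exact dist_affineSimplex_le hx _
      | succ j => exact hv1 x r (fun _ => hx _) j
    · cases j using Fin.cases with
      | zero =>
        cases k using Fin.cases with
        | zero => simp only [Fin.cons_zero, dist_self]; positivity
        | succ k => exact hb k
      | succ j =>
        cases k using Fin.cases with
        | zero => rw [dist_comm]; exact hb j
        | succ k => exact hv2 j k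

theorem iterate_sd_mem_chainsIn {m N n : ℕ} (hn : n ≤ N + 1) {D : ℝ} (hD : 0 ≤ D)
    (w : Fin n → TopSimplex m) (hw : ∀ i j, dist (w i) (w j) ≤ D) (k : ℕ) :
    (sd m n)^[k] (of w) ∈ chainsIn fun v : Fin n → TopSimplex m =>
      ∀ i j, dist (v i) (v j) ≤ (N / (N + 1)) ^ k * D := by
  induction k with
  | zero => simpa using of_mem_chainsIn hw
  | succ k ih =>
    rw [Function.iterate_succ_apply']
    refine apply_mem_of_mem_chainsIn _ (fun v hv => ?_) ih
    have := sd_of_mem_chainsIn hn (by positivity) v hv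
    refine apply_mem_of_mem_chainsIn (AddMonoidHom.id _) (fun v' hv' => ?_) this
    refine of_mem_chainsIn fun i j => ?_
    rw [pow_succ', mul_assoc]
    exact hv'.2 i j

end AffineChain
end AffineSimplices

/-! ### The theorem of small simplices -/

section SmallSimplices

open FreeAbelianGroup (of lift)

variable {X Y : Type u} [TopologicalSpace X] [TopologicalSpace Y] {R : Type v} [Ring R]

namespace Cochains

/-- The value of a singular cochain on the image of an affine chain under a map `φ` from a standard
simplex. It vanishes on multiples of the empty list. -/
noncomputable def eval (c : Cochains (singularSet X) R) {m : ℕ} (φ : C(TopSimplex m, X)) :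
    ∀ n, AffineChain n (TopSimplex m) →+ R
  | 0 => 0
  | n + 1 => lift fun v => c n ((simplexEquiv X n).symm (φ.comp (affineSimplex v)))

open CategoryTheory
open scoped Simplicial

theorem eval_of (c : Cochains (singularSet X) R) {m n : ℕ} (φ : C(TopSimplex m, X))
    (v : Fin (n + 1) → TopSimplex m) :
    eval c φ (n + 1) (of v) = c n ((simplexEquiv X n).symm (φ.comp (affineSimplex v))) :=
  FreeAbelianGroup.lift_apply_of _ _

theorem eval_stdVertices (c : Cochains (singularSet X) R) {n : ℕ} (τ : singularSet X _⦋n⦌) :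
    eval c (simplexEquiv X n τ) (n + 1) (of (stdVertices n)) = c n τ := by
  rw [eval_of, affineSimplex_stdVertices, ContinuousMap.comp_id, Equiv.symm_apply_apply]

theorem eval_d (c : Cochains (singularSet X) R) {m n : ℕ} (φ : C(TopSimplex m, X))
    (x : AffineChain (n + 1) (TopSimplex m)) :
    eval (d c) φ (n + 1) x = eval c φ n (AffineChain.boundary n x) := by
  refine DFunLike.congr_fun (f := eval (d c) φ (n + 1))
    (g := (eval c φ n).comp (AffineChain.boundary n)) (FreeAbelianGroup.lift_ext _ _ fun v => ?_) x
  rw [AddMonoidHom.comp_apply, eval_of]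
  cases n with
  | zero => rfl
  | succ n =>
    rw [d_succ_apply, AffineChain.boundary_of, map_sum]
    refine Finset.sum_congr rfl fun i _ => ?_
    rw [map_zsmul, eval_of, act_simplexEquiv_symm, ContinuousMap.comp_assoc]
    have : (affineSimplex v).comp
        ⟨_, stdSimplex.continuous_map (SimplexCategory.δ i).toOrderHom⟩ =
        affineSimplex (v ∘ i.succAbove) := affineSimplex_comp_face v i
    rw [this]
    simp

theorem eval_map (c : Cochains (singularSet X) R) {k m n : ℕ} (φ : C(TopSimplex m, X))
    (w : Fin (k + 1) → TopSimplex m) (x : AffineChain n (TopSimplex k)) :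
    eval c φ n (AffineChain.map (affineSimplex w) x) =
      eval c (φ.comp (affineSimplex w)) n x := by
  refine DFunLike.congr_fun (f := (eval c φ n).comp (AffineChain.map (affineSimplex w)))
    (FreeAbelianGroup.lift_ext _ _ fun v => ?_) x
  cases n with
  | zero => rfl
  | succ n =>
    rw [AddMonoidHom.comp_apply, AffineChain.map_of, eval_of, eval_of, ContinuousMap.comp_assoc,
      affineSimplex_comp]

theorem eval_pull (f : C(X, Y)) (c : Cochains (singularSet Y) R) {m n : ℕ} (φ : C(TopSimplex m, X))
    (x : AffineChain n (TopSimplex m)) : eval (pull f c) φ n x = eval c (f.comp φ) n x := by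
  refine DFunLike.congr_fun (FreeAbelianGroup.lift_ext _ _ fun v => ?_) x
  cases n with
  | zero => rfl
  | succ n => rw [eval_of, eval_of, pull_apply, map_simplexEquiv_symm, ContinuousMap.comp_assoc]

theorem eval_eq_zero {c : Cochains (singularSet X) R} {N : ℕ} (hc : ∀ n, N ≤ n → ∀ τ, c n τ = 0)
    {m n : ℕ} (hn : N < n) (φ : C(TopSimplex m, X)) (x : AffineChain n (TopSimplex m)) :
    eval c φ n x = 0 := by
  refine DFunLike.congr_fun (g := 0) (FreeAbelianGroup.lift_ext _ _ fun v => ?_) x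
  cases n with
  | zero => rfl
  | succ n => rw [eval_of, hc _ (Nat.lt_succ_iff.1 hn)]; rfl

theorem eval_zero {m n : ℕ} (φ : C(TopSimplex m, X)) (x : AffineChain n (TopSimplex m)) :
    eval (0 : Cochains (singularSet X) R) φ n x = 0 := by
  cases n with
  | zero => rfl
  | succ n => exact eval_eq_zero (N := 0) (fun _ _ _ => rfl) n.succ_pos φ x

theorem eval_sub (c c' : Cochains (singularSet X) R) {m n : ℕ} (φ : C(TopSimplex m, X))
    (x : AffineChain n (TopSimplex m)) : eval (c - c') φ n x = eval c φ n x - eval c' φ n x := by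
  refine DFunLike.congr_fun (g := eval c φ n - eval c' φ n)
    (FreeAbelianGroup.lift_ext _ _ fun v => ?_) x
  rw [AddMonoidHom.sub_apply]
  cases n with
  | zero => exact (sub_zero (0 : R)).symm
  | succ n => rw [eval_of, eval_of, eval_of, sub_apply]

/-- The operator on cochains that is dual to an operator of degree `k` on affine chains. -/
noncomputable def dualOp {k : ℕ}
    (F : ∀ m n, AffineChain n (TopSimplex m) →+ AffineChain (n + k) (TopSimplex m))
    (c : Cochains (singularSet X) R) : Cochains (singularSet X) R :=
  ⟨fun n τ => eval c (simplexEquiv X n τ) (n + 1 + k) (F n (n + 1) (of (stdVertices n)))⟩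

section dualOp

variable {k : ℕ} (F : ∀ m n, AffineChain n (TopSimplex m) →+ AffineChain (n + k) (TopSimplex m))

theorem dualOp_apply (c : Cochains (singularSet X) R) (n : ℕ) (τ : singularSet X _⦋n⦌) :
    dualOp F c n τ =
      eval c (simplexEquiv X n τ) (n + 1 + k) (F n (n + 1) (of (stdVertices n))) := rfl

theorem pull_dualOp (f : C(X, Y)) (c : Cochains (singularSet Y) R) :
    pull f (dualOp F c) = dualOp F (pull f c) := by
  ext n τ
  rw [pull_apply, dualOp_apply, dualOp_apply, eval_pull, simplexEquiv_map]

theorem dualOp_zero : dualOp F (0 : Cochains (singularSet X) R) = 0 := by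
  ext n τ
  rw [dualOp_apply, eval_zero, zero_apply]

theorem dualOp_sub (c c' : Cochains (singularSet X) R) :
    dualOp F (c - c') = dualOp F c - dualOp F c' := by
  ext n τ
  rw [sub_apply, dualOp_apply, eval_sub]
  rfl

theorem dualOp_eq_zero {c : Cochains (singularSet X) R} {N : ℕ} (hc : ∀ n, N ≤ n → ∀ τ, c n τ = 0)
    (n : ℕ) (hn : N ≤ n) (τ) : dualOp F c n τ = 0 := by
  rw [dualOp_apply, eval_eq_zero hc (by omega)]

variable {F} in
theorem eval_dualOp
    (hF : ∀ (l m n : ℕ) (w : Fin (l + 1) → TopSimplex m) (x : AffineChain n (TopSimplex l)),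
      AffineChain.map (affineSimplex w) (F l n x) = F m n (AffineChain.map (affineSimplex w) x))
    (c : Cochains (singularSet X) R) {m n : ℕ} (φ : C(TopSimplex m, X))
    (x : AffineChain (n + 1) (TopSimplex m)) :
    eval (dualOp F c) φ (n + 1) x = eval c φ (n + 1 + k) (F m (n + 1) x) := by
  refine DFunLike.congr_fun (f := eval (dualOp F c) φ (n + 1))
    (g := (eval c φ (n + 1 + k)).comp (F m (n + 1))) (FreeAbelianGroup.lift_ext _ _ fun v => ?_) x
  rw [eval_of, dualOp_apply, Equiv.apply_symm_apply, ← eval_map, hF, AffineChain.map_of,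
    affineSimplex_vertices]
  rfl

end dualOp

/-- The subdivision of singular cochains. -/
noncomputable def sd (c : Cochains (singularSet X) R) : Cochains (singularSet X) R :=
  dualOp (k := 0) AffineChain.sd c

/-- The homotopy between the identity and the subdivision of singular cochains. -/
noncomputable def sdHomotopy (c : Cochains (singularSet X) R) : Cochains (singularSet X) R :=
  dualOp (k := 1) AffineChain.sdHomotopy c

theorem eval_sd (c : Cochains (singularSet X) R) {m n : ℕ} (φ : C(TopSimplex m, X))
    (x : AffineChain (n + 1) (TopSimplex m)) :
    eval (sd c) φ (n + 1) x = eval c φ (n + 1) (AffineChain.sd m (n + 1) x) :=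
  eval_dualOp (k := 0) (fun _ _ _ w _ =>
    AffineChain.map_subdivision (fun _ _ => affineSimplex_listBarycenter w _) _) c φ x

theorem eval_sdHomotopy (c : Cochains (singularSet X) R) {m n : ℕ} (φ : C(TopSimplex m, X))
    (x : AffineChain (n + 1) (TopSimplex m)) :
    eval (sdHomotopy c) φ (n + 1) x = eval c φ (n + 2) (AffineChain.sdHomotopy m (n + 1) x) :=
  eval_dualOp (k := 1) (fun _ _ _ w _ =>
    AffineChain.map_subdivisionHomotopy (fun _ _ => affineSimplex_listBarycenter w _) _) c φ x

theorem eval_iterate_sd (c : Cochains (singularSet X) R) {m n : ℕ} (φ : C(TopSimplex m, X)) (i : ℕ)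
    (x : AffineChain (n + 1) (TopSimplex m)) :
    eval (sd^[i] c) φ (n + 1) x = eval c φ (n + 1) ((AffineChain.sd m (n + 1))^[i] x) := by
  induction i generalizing x with
  | zero => rfl
  | succ i ih => rw [Function.iterate_succ_apply', eval_sd, ih, Function.iterate_succ_apply]

theorem d_sd (c : Cochains (singularSet X) R) : d (sd c) = sd (d c) := by
  ext n τ
  rw [← eval_stdVertices (d (sd c)), ← eval_stdVertices (sd (d c)), eval_sd, eval_d, eval_d]
  cases n with
  | zero => rfl
  | succ n => rw [eval_sd, AffineChain.boundary_subdivision]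

theorem d_sdHomotopy (c : Cochains (singularSet X) R) :
    d (sdHomotopy c) + sdHomotopy (d c) = c - sd c := by
  ext n τ
  rw [add_apply, sub_apply, ← eval_stdVertices (d (sdHomotopy c)),
    ← eval_stdVertices (sdHomotopy (d c)), ← eval_stdVertices (sd c), ← eval_stdVertices c,
    eval_sd, eval_sdHomotopy, eval_d, eval_d, ← map_sub,
    ← AffineChain.boundary_subdivisionHomotopy, map_add, add_comm]
  congr 1
  cases n with
  | zero => exact (map_zero (eval c (simplexEquiv X 0 τ) 1)).symm
  | succ n => rw [eval_sdHomotopy]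

theorem d_iterate_sd (c : Cochains (singularSet X) R) (i : ℕ) : d (sd^[i] c) = sd^[i] (d c) :=
  (Function.Semiconj.iterate_right (f := d) (fun c => d_sd c) i).eq c

theorem sd_sub (c c' : Cochains (singularSet X) R) : sd (c - c') = sd c - sd c' := dualOp_sub _ _ _

theorem iterate_sd_sub (c c' : Cochains (singularSet X) R) (i : ℕ) :
    sd^[i] (c - c') = sd^[i] c - sd^[i] c' := by
  induction i with
  | zero => rfl
  | succ i ih => rw [Function.iterate_succ_apply', ih, sd_sub, Function.iterate_succ_apply',
      Function.iterate_succ_apply']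

/-- The terms of the telescoping sum that exhibits a cocycle as a coboundary. -/
theorem d_iterate_sd_sdHomotopy {c : Cochains (singularSet X) R} (hc : d c = 0) (i : ℕ) :
    d (sd^[i] (sdHomotopy c)) = sd^[i] c - sd^[i + 1] c := by
  have h := d_sdHomotopy c
  rw [hc, sdHomotopy, sdHomotopy, dualOp_zero, add_zero] at h
  rw [d_iterate_sd, sdHomotopy, h, iterate_sd_sub, ← Function.iterate_succ_apply]

theorem pull_iterate_sd (f : C(X, Y)) (c : Cochains (singularSet Y) R) (i : ℕ) :
    pull f (sd^[i] c) = sd^[i] (pull f c) :=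
  (Function.Semiconj.iterate_right (f := pull f) (fun c => pull_dualOp _ f c) i).eq c

theorem iterate_sd_eq_zero {c : Cochains (singularSet X) R} {N : ℕ}
    (hc : ∀ n, N ≤ n → ∀ τ, c n τ = 0) (i n : ℕ) (hn : N ≤ n) (τ) : sd^[i] c n τ = 0 := by
  induction i generalizing n with
  | zero => exact hc n hn τ
  | succ i ih =>
    rw [Function.iterate_succ_apply']
    exact dualOp_eq_zero _ ih n hn τ

theorem iterate_sd_zero (i : ℕ) : sd^[i] (0 : Cochains (singularSet X) R) = 0 :=
  Function.iterate_fixed (f := sd) (dualOp_zero _) i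

/-- The inclusion of a subspace. -/
def subspaceIncl (U : Set X) : C(U, X) := ⟨Subtype.val, continuous_subtype_val⟩

theorem apply_eq_zero_of_pull_subspaceIncl {U : Set X} {c : Cochains (singularSet X) R}
    (hc : pull (subspaceIncl U) c = 0) {n : ℕ} (φ : C(TopSimplex n, X)) (hφ : ∀ t, φ t ∈ U) :
    c n ((simplexEquiv X n).symm φ) = 0 := by
  let ψ : C(TopSimplex n, U) := ⟨fun t => ⟨φ t, hφ t⟩, φ.continuous.subtype_mk _⟩
  have : c n ((simplexEquiv X n).symm φ) =
      pull (subspaceIncl U) c n ((simplexEquiv U n).symm ψ) := by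
    rw [pull_apply, map_simplexEquiv_symm]
    rfl
  rw [this, hc, zero_apply]

/-- Sufficiently fine iterated subdivisions of a given simplex consist of small simplices. -/
theorem exists_iterate_sd_apply_eq_zero {ι : Type*} {U : ι → Set X} (hU : ∀ i, IsOpen (U i))
    (hcov : ⋃ i, U i = Set.univ) {n : ℕ} (τ : singularSet X _⦋n⦌) :
    ∃ m, ∀ j, m ≤ j → ∀ c : Cochains (singularSet X) R,
      (∀ i, pull (subspaceIncl (U i)) c = 0) → (sd^[j] c) n τ = 0 := by
  set φ := simplexEquiv X n τ with hφ
  obtain ⟨δ, hδ, hball⟩ := lebesgue_number_lemma_of_metric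
    (isCompact_univ (X := TopSimplex n)) (c := fun i => φ ⁻¹' U i)
    (fun i => (hU i).preimage φ.continuous) (by rw [← Set.preimage_iUnion, hcov]; simp)
  -- A bound for the diameter of the standard simplex.
  obtain ⟨D, hD⟩ := Metric.isBounded_iff.1 (isCompact_univ (X := TopSimplex n)).isBounded
  have hD' : ∀ x y : TopSimplex n, dist x y ≤ D := fun x y => hD trivial trivial
  have hD0 : 0 ≤ D := dist_nonneg.trans (hD' (stdVertices n 0) (stdVertices n 0))
  have hlim : Filter.Tendsto (fun m : ℕ => ((n : ℝ) / (n + 1)) ^ m * D) Filter.atTop (nhds 0) := by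
    have := (tendsto_pow_atTop_nhds_zero_of_lt_one (r := (n : ℝ) / (n + 1)) (by positivity)
      ((div_lt_one (by positivity)).2 (by linarith))).mul_const D
    rwa [zero_mul] at this
  obtain ⟨m, hm⟩ := Filter.eventually_atTop.1 (hlim.eventually (gt_mem_nhds hδ))
  refine ⟨m, fun j hj c hc => ?_⟩
  rw [← eval_stdVertices, eval_iterate_sd, ← hφ]
  have hmem := AffineChain.iterate_sd_mem_chainsIn (le_refl (n + 1)) hD0 (stdVertices n)
    (fun _ _ => hD' _ _) j
  have := AffineChain.apply_mem_of_mem_chainsIn (H := ⊥) (eval c φ (n + 1)) (fun v hv => ?_) hmem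
  · simpa using this
  · obtain ⟨i, hi⟩ := hball (v 0) trivial
    rw [eval_of, AddSubgroup.mem_bot]
    refine apply_eq_zero_of_pull_subspaceIncl (hc i) _ fun t => hi ?_
    exact (dist_affineSimplex_le (fun k => hv k 0) t).trans_lt (hm j hj)

/-- The theorem of small simplices: the complex of those cochains that vanish on all simplices
contained in one of the sets of an open cover is acyclic. -/
theorem exists_d_eq_of_pull_subspaceIncl {ι : Type*} {U : ι → Set X} (hU : ∀ i, IsOpen (U i))
    (hcov : ⋃ i, U i = Set.univ) {c : Cochains (singularSet X) R} (hb : IsBounded c) (hc : d c = 0)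
    (hcU : ∀ i, pull (subspaceIncl (U i)) c = 0) :
    ∃ e : Cochains (singularSet X) R, IsBounded e ∧ d e = c ∧
      ∀ i, pull (subspaceIncl (U i)) e = 0 := by
  choose m hm using fun (n : ℕ) (τ : singularSet X _⦋n⦌) =>
    exists_iterate_sd_apply_eq_zero (R := R) hU hcov τ
  have hT : ∀ i, pull (subspaceIncl (U i)) (sdHomotopy c) = 0 := fun i => by
    rw [sdHomotopy, pull_dualOp, hcU, dualOp_zero]
  -- The further terms of the sum vanish, so a common range can be used for a simplex and its faces.
  have hsum : ∀ (n : ℕ) (τ : singularSet X _⦋n⦌) (M : ℕ), m n τ ≤ M →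
      ∑ i ∈ Finset.range (m n τ), (sd^[i] (sdHomotopy c)) n τ =
        ∑ i ∈ Finset.range M, (sd^[i] (sdHomotopy c)) n τ := fun n τ M hM =>
    Finset.sum_subset (Finset.range_subset_range.2 hM) fun i _ hi =>
      hm n τ i (by simpa using hi) _ hT
  refine ⟨⟨fun n τ => ∑ i ∈ Finset.range (m n τ), (sd^[i] (sdHomotopy c)) n τ⟩, ?_, ?_, ?_⟩
  · obtain ⟨N, hN⟩ := hb
    refine ⟨N, fun n hn τ => ?_⟩
    change ∑ i ∈ Finset.range (m n τ), (sd^[i] (sdHomotopy c)) n τ = 0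
    exact Finset.sum_eq_zero fun i _ => iterate_sd_eq_zero (dualOp_eq_zero _ hN) i n hn τ
  · ext n τ
    have key : ∀ M, m n τ ≤ M →
        ∑ i ∈ Finset.range M, d (sd^[i] (sdHomotopy c)) n τ = c n τ := fun M hM => by
      simp only [d_iterate_sd_sdHomotopy hc, sub_apply]
      rw [Finset.sum_range_sub' (fun i => (sd^[i] c) n τ), hm n τ M hM c hcU, sub_zero]
      rfl
    cases n with
    | zero => rw [← key _ le_rfl]; simp only [d_zero_apply, Finset.sum_const_zero]
    | succ n =>
      rw [← key (m (n + 1) τ + ∑ j : Fin (n + 2), m n (SSet.act _ (SimplexCategory.δ j) τ))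
        (by omega)]
      simp only [d_succ_apply]
      rw [Finset.sum_comm]
      refine Finset.sum_congr rfl fun j _ => ?_
      rw [← Finset.mul_sum]
      congr 1
      exact hsum n _ _ ((Finset.single_le_sum
        (f := fun j => m n (SSet.act _ (SimplexCategory.δ j) τ))
        (fun _ _ => Nat.zero_le _) (Finset.mem_univ j)).trans (Nat.le_add_left _ _))
  · intro i
    ext n τ
    change ∑ j ∈ Finset.range (m n _), pull (subspaceIncl (U i)) (sd^[j] (sdHomotopy c)) n τ = 0
    refine Finset.sum_eq_zero fun j _ => ?_
    rw [pull_iterate_sd, hT, iterate_sd_zero, zero_apply]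

end Cochains
end SmallSimplices

/-! ### Homotopy invariance -/

section HomotopyInvariance

open CategoryTheory
open scoped Simplicial

namespace Cochains
variable {R : Type v} [Ring R] {S T : SSet.{u}}

/-- The simplicial chain complex of a simplicial set, with integral coefficients. -/
noncomputable abbrev chainComplex (S : SSet.{u}) : ChainComplex AddCommGrpCat.{u} ℕ :=
  (AlgebraicTopology.alternatingFaceMapComplex _).obj
    (((SimplicialObject.whiskering _ _).obj AddCommGrpCat.free).obj S)

/-- The boundary of simplicial chains. -/
noncomputable def chainBoundary (S : SSet.{u}) (n : ℕ) :
    FreeAbelianGroup (S _⦋n + 1⦌) →+ FreeAbelianGroup (S _⦋n⦌) :=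
  ((chainComplex S).d (n + 1) n).hom

theorem hom_sum_zsmul_apply {M N : AddCommGrpCat.{u}} {ι : Type} (s : Finset ι) (z : ι → ℤ)
    (f : ι → (M ⟶ N)) (x : M) : (∑ i ∈ s, z i • f i).hom x = ∑ i ∈ s, z i • (f i).hom x := by
  have h : (∑ i ∈ s, z i • f i).hom = ∑ i ∈ s, z i • (f i).hom := by
    change AddCommGrpCat.homAddEquiv _ = _
    rw [map_sum]
    rfl
  rw [h, AddMonoidHom.finsetSum_apply]
  rfl

theorem chainBoundary_of (n : ℕ) (τ : S _⦋n + 1⦌) :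
    chainBoundary S n (FreeAbelianGroup.of τ) =
      ∑ i : Fin (n + 2), (-1 : ℤ) ^ (i : ℕ) •
        FreeAbelianGroup.of (S.act (SimplexCategory.δ i) τ) := by
  refine (DFunLike.congr_fun (congrArg AddCommGrpCat.Hom.hom
    (AlgebraicTopology.alternatingFaceMapComplex_obj_d
      (((SimplicialObject.whiskering _ _).obj AddCommGrpCat.free).obj S) n)) _).trans ?_
  refine (hom_sum_zsmul_apply (M := AddCommGrpCat.of (FreeAbelianGroup (S _⦋n + 1⦌)))
    (N := AddCommGrpCat.of (FreeAbelianGroup (S _⦋n⦌))) Finset.univ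
    (fun i : Fin (n + 2) => (-1) ^ (i : ℕ)) (fun i => AddCommGrpCat.free.map (S.δ i)) _).trans ?_
  refine Finset.sum_congr rfl fun i _ => congrArg _ ?_
  exact FreeAbelianGroup.map_of_apply _

theorem chainBoundary_chainBoundary (n : ℕ) (x : FreeAbelianGroup (S _⦋n + 2⦌)) :
    chainBoundary S n (chainBoundary S (n + 1) x) = 0 :=
  DFunLike.congr_fun (congrArg AddCommGrpCat.Hom.hom
    ((chainComplex S).d_comp_d (n + 2) (n + 1) n)) x

theorem d_succ_eq_lift (c : Cochains S R) (n : ℕ) (τ : S _⦋n + 1⦌) :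
    d c (n + 1) τ =
      FreeAbelianGroup.lift (c n) (chainBoundary S n (FreeAbelianGroup.of τ)) := by
  rw [chainBoundary_of, map_sum, d_succ_apply]
  refine Finset.sum_congr rfl fun i _ => ?_
  rw [map_zsmul, FreeAbelianGroup.lift_apply_of]
  simp

theorem lift_d (c : Cochains S R) (n : ℕ) (x : FreeAbelianGroup (S _⦋n + 1⦌)) :
    FreeAbelianGroup.lift (d c (n + 1)) x =
      FreeAbelianGroup.lift (c n) (chainBoundary S n x) := by
  have : FreeAbelianGroup.lift (d c (n + 1)) =
      (FreeAbelianGroup.lift (c n)).comp (chainBoundary S n) :=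
    FreeAbelianGroup.lift_ext _ _ fun τ => by
      rw [FreeAbelianGroup.lift_apply_of, d_succ_eq_lift]; rfl
  exact DFunLike.congr_fun this x

theorem d_d (c : Cochains S R) : d (d c) = 0 := by
  ext n τ
  match n with
  | 0 => rfl
  | 1 => simp [d_succ_apply, d_zero_apply]
  | n + 2 => rw [d_succ_eq_lift, lift_d, chainBoundary_chainBoundary, map_zero, zero_apply]

/-- The prism operator of a simplicial homotopy. Degree `0` is separate, since there is no boundary
to lower degrees. -/
theorem exists_prism {f g : S ⟶ T} (H : SimplicialObject.Homotopy f g) :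
    ∃ P : ∀ n, FreeAbelianGroup (S _⦋n⦌) →+ FreeAbelianGroup (T _⦋n + 1⦌),
      (∀ τ : S _⦋0⦌, FreeAbelianGroup.of (f.app _ τ) - FreeAbelianGroup.of (g.app _ τ) =
        chainBoundary T 0 (P 0 (FreeAbelianGroup.of τ))) ∧
      ∀ n, ∀ τ : S _⦋n + 1⦌, FreeAbelianGroup.of (f.app _ τ) - FreeAbelianGroup.of (g.app _ τ) =
        P n (chainBoundary S n (FreeAbelianGroup.of τ)) +
          chainBoundary T (n + 1) (P (n + 1) (FreeAbelianGroup.of τ)) := by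
  let K := (H.whiskerRight AddCommGrpCat.free).toChainHomotopy
  refine ⟨fun n => (K.hom n (n + 1)).hom, fun τ => ?_, fun n τ => ?_⟩
  · have key := K.comm 0
    rw [prevD_eq (j' := 1) (w := by simp), dNext_eq_zero _ _ (by simp), zero_add] at key
    exact sub_eq_iff_eq_add.2 (DFunLike.congr_fun (congrArg AddCommGrpCat.Hom.hom key)
      (FreeAbelianGroup.of τ))
  · have key := K.comm (n + 1)
    rw [dNext_eq (i' := n) (w := by simp), prevD_eq (j' := n + 2) (w := by simp)] at key
    exact sub_eq_iff_eq_add.2 (DFunLike.congr_fun (congrArg AddCommGrpCat.Hom.hom key)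
      (FreeAbelianGroup.of τ))

theorem isCoboundary_comap_sub {f g : S ⟶ T}
    (H : SimplicialObject.Homotopy f g) {c : Cochains T R} (hb : IsBounded c) (hc : d c = 0) :
    IsCoboundary (comap f c - comap g c) := by
  obtain ⟨P, hP0, hP⟩ := exists_prism H
  refine ⟨⟨fun n τ => FreeAbelianGroup.lift (c (n + 1)) (P n (FreeAbelianGroup.of τ))⟩, ?_, ?_⟩
  · obtain ⟨N, hN⟩ := hb
    refine ⟨N, fun n hn τ => ?_⟩
    have : c (n + 1) = fun _ => 0 := funext fun σ => hN _ (by omega) σ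
    change FreeAbelianGroup.lift (c (n + 1)) _ = 0
    rw [this]
    have h0 : FreeAbelianGroup.lift (fun _ : T _⦋n + 1⦌ => (0 : R)) = 0 :=
      FreeAbelianGroup.lift_ext _ _ fun τ => by simp
    rw [h0, AddMonoidHom.zero_apply]
  · ext n τ
    have e : (comap f c - comap g c) n τ = FreeAbelianGroup.lift (c n)
        (FreeAbelianGroup.of (f.app _ τ) - FreeAbelianGroup.of (g.app _ τ)) := by
      rw [map_sub, FreeAbelianGroup.lift_apply_of, FreeAbelianGroup.lift_apply_of, sub_apply]
      rfl
    rw [e]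
    cases n with
    | zero =>
      rw [hP0, ← lift_d, hc]
      have h0 : FreeAbelianGroup.lift ((0 : Cochains T R) 1) = 0 :=
        FreeAbelianGroup.lift_ext _ _ fun τ => by simp
      rw [h0]; rfl
    | succ n =>
      rw [hP, map_add, ← lift_d, hc]
      have h0 : FreeAbelianGroup.lift ((0 : Cochains T R) (n + 2)) = 0 :=
        FreeAbelianGroup.lift_ext _ _ fun τ => by simp
      rw [h0, AddMonoidHom.zero_apply, add_zero, d_succ_eq_lift]
      have : ∀ x : FreeAbelianGroup (S _⦋n⦌), FreeAbelianGroup.lift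
          (fun τ => FreeAbelianGroup.lift (c (n + 1)) (P n (FreeAbelianGroup.of τ))) x =
          FreeAbelianGroup.lift (c (n + 1)) (P n x) := fun x =>
        DFunLike.congr_fun
          (FreeAbelianGroup.lift_ext _ ((FreeAbelianGroup.lift (c (n + 1))).comp (P n))
          fun τ => by simp) x
      exact this _

/-- Homotopy invariance of singular cohomology, at the level of cocycles. -/
theorem isCoboundary_pull_sub {X Y : Type u} [TopologicalSpace X] [TopologicalSpace Y]
    {f g : C(X, Y)} (H : f.Homotopic g) {c : Cochains (singularSet Y) R} (hb : IsBounded c)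
    (hc : d c = 0) :
    IsCoboundary (pull f c - pull g c) := by
  obtain ⟨H⟩ := H
  have H' : TopCat.Homotopy (TopCat.ofHom f) (TopCat.ofHom g) := H
  exact isCoboundary_comap_sub H'.toSSet.toSimplicialObjectHomotopy hb hc

end Cochains
end HomotopyInvariance

/-! ### Cohomology classes and cochains on subspaces -/

section CohomologyClasses

open CategoryTheory
open scoped Simplicial
open Cochains

variable {X Y Z : Type u} [TopologicalSpace X] [TopologicalSpace Y] [TopologicalSpace Z]
  {R : Type v} [Ring R]

namespace Cochains

theorem IsBounded.d {S : SSet.{u}} {c : Cochains S R} (hc : IsBounded c) : IsBounded (d c) := by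
  obtain ⟨N, hN⟩ := hc
  refine ⟨N + 1, fun n hn τ => ?_⟩
  obtain ⟨n, rfl⟩ : ∃ m, n = m + 1 := ⟨n - 1, by omega⟩
  rw [d_succ_apply]
  exact Finset.sum_eq_zero fun i _ => by rw [hN n (by omega), mul_zero]

theorem IsCoboundary.add {S : SSet.{u}} {c c' : Cochains S R} (hc : IsCoboundary c)
    (hc' : IsCoboundary c') : IsCoboundary (c + c') := by
  obtain ⟨b, hb, rfl⟩ := hc
  obtain ⟨b', hb', rfl⟩ := hc'
  exact ⟨b + b', hb.add hb', d_add _ _⟩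

theorem IsCoboundary.neg {S : SSet.{u}} {c : Cochains S R} (hc : IsCoboundary c) :
    IsCoboundary (-c) := by
  obtain ⟨b, hb, rfl⟩ := hc
  exact ⟨-b, hb.neg, d_neg _⟩

theorem IsCoboundary.pull (f : C(X, Y)) {c : Cochains (singularSet Y) R} (hc : IsCoboundary c) :
    IsCoboundary (pull f c) := by
  obtain ⟨b, hb, rfl⟩ := hc
  exact ⟨Cochains.pull f b, hb.pull f, (pull_d _ _).symm⟩

theorem IsCoboundary.pull_of_homotopic {f g : C(X, Y)} (H : f.Homotopic g)
    {c : Cochains (singularSet Y) R} (hb : IsBounded c) (hc : d c = 0)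
    (h : IsCoboundary (Cochains.pull g c)) : IsCoboundary (Cochains.pull f c) := by
  simpa using (isCoboundary_pull_sub H hb hc).add h

/-- The extension by zero of a cochain on a subspace to all simplices that do not lie in it. -/
noncomputable def extendZero (U : Set X) (z : Cochains (singularSet U) R) :
    Cochains (singularSet X) R :=
  open scoped Classical in
  ⟨fun n τ => if h : ∀ t, simplexEquiv X n τ t ∈ U then
    z n ((simplexEquiv U n).symm ⟨fun t => ⟨simplexEquiv X n τ t, h t⟩,
      (simplexEquiv X n τ).continuous.subtype_mk _⟩) else 0⟩

theorem pull_extendZero (U : Set X) (z : Cochains (singularSet U) R) :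
    pull (subspaceIncl U) (extendZero U z) = z := by
  ext n τ
  have h : ∀ t, simplexEquiv X n ((singularSetMap (subspaceIncl U)).app _ τ) t ∈ U := fun t => by
    rw [simplexEquiv_map]
    exact (simplexEquiv U n τ t).2
  rw [pull_apply, extendZero]
  refine (dif_pos h).trans (congrArg (z n) ?_)
  rw [Equiv.symm_apply_eq]
  rfl

theorem IsBounded.extendZero {U : Set X} {z : Cochains (singularSet U) R} (hz : IsBounded z) :
    IsBounded (extendZero U z) := by
  obtain ⟨N, hN⟩ := hz
  refine ⟨N, fun n hn τ => ?_⟩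
  rw [Cochains.extendZero]
  simp only [hN n hn, dite_eq_ite, ite_self]

/-- The inclusion of subspaces. -/
def subspaceMap {U V : Set X} (h : U ⊆ V) : C(U, V) := ⟨Set.inclusion h, continuous_inclusion h⟩

theorem subspaceIncl_comp_subspaceMap {U V : Set X} (h : U ⊆ V) :
    (subspaceIncl V).comp (subspaceMap h) = subspaceIncl U := rfl

/-- If `v` vanishes on `U ∩ V`, its extension by zero from `V` vanishes on `U`. -/
theorem pull_extendZero_of_inter {U V : Set X} {v : Cochains (singularSet V) R}
    (hv : pull (subspaceMap (Set.inter_subset_right (s := U))) v = 0) :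
    pull (subspaceIncl U) (extendZero V v) = 0 := by
  ext n τ
  rw [pull_apply, extendZero]
  by_cases h : ∀ t, simplexEquiv X n ((singularSetMap (subspaceIncl U)).app _ τ) t ∈ V
  · refine (dif_pos h).trans ?_
    have h' : ∀ t, (simplexEquiv U n τ t).1 ∈ U ∩ V := fun t => ⟨(simplexEquiv U n τ t).2, h t⟩
    let ψ : C(TopSimplex n, ↥(U ∩ V)) := ⟨fun t => ⟨(simplexEquiv U n τ t).1, h' t⟩,
      (continuous_subtype_val.comp (simplexEquiv U n τ).continuous).subtype_mk _⟩
    have e : pull (subspaceMap (Set.inter_subset_right (s := U))) v n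
        ((simplexEquiv _ n).symm ψ) = 0 := by rw [hv, zero_apply]
    rw [pull_apply, map_simplexEquiv_symm] at e
    exact e
  · exact dif_neg h

/-- Cochains on two subspaces that agree on the intersection have a common extension. -/
theorem exists_glue {U V : Set X} {a : Cochains (singularSet U) R} {b : Cochains (singularSet V) R}
    (ha : IsBounded a) (hb : IsBounded b)
    (h : pull (subspaceMap (Set.inter_subset_left (t := V))) a =
      pull (subspaceMap (Set.inter_subset_right (s := U))) b) :
    ∃ c : Cochains (singularSet X) R, IsBounded c ∧ pull (subspaceIncl U) c = a ∧
      pull (subspaceIncl V) c = b := by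
  -- The second summand corrects the values on `V` without changing those on `U`.
  refine ⟨extendZero U a + extendZero V (b - pull (subspaceIncl V) (extendZero U a)),
    ha.extendZero.add (hb.sub (ha.extendZero.pull _)).extendZero, ?_, ?_⟩
  · rw [map_add, pull_extendZero, pull_extendZero_of_inter, add_zero]
    rw [map_sub, ← pull_comp, subspaceIncl_comp_subspaceMap,
      ← subspaceIncl_comp_subspaceMap (Set.inter_subset_left (t := V)), pull_comp,
      pull_extendZero, h, sub_self]
  · rw [map_add, pull_extendZero, add_sub_cancel]

end Cochains

namespace SingularCohomology

/-- The cohomology class of a cocycle. -/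
noncomputable abbrev ofCocycle (z : cocycles (singularSet X) R) : SingularCohomology R X :=
  Ideal.Quotient.mk _ z

theorem ofCocycle_eq_zero {z : cocycles (singularSet X) R} : ofCocycle z = 0 ↔ IsCoboundary z.1 :=
  Ideal.Quotient.eq_zero_iff_mem

theorem ofCocycle_eq_ofCocycle {z w : cocycles (singularSet X) R} :
    ofCocycle z = ofCocycle w ↔ IsCoboundary (z.1 - w.1) :=
  Ideal.Quotient.eq

theorem map_ofCocycle (f : C(X, Y)) (z : cocycles (singularSet Y) R) :
    SingularCohomology.map R f (ofCocycle z) =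
      ofCocycle ⟨pull f z.1, z.2.1.pull f, by rw [← pull_d, z.2.2, map_zero]⟩ := rfl

theorem map_ofCocycle_eq_zero {f : C(X, Y)} {z : cocycles (singularSet Y) R} :
    SingularCohomology.map R f (ofCocycle z) = 0 ↔ IsCoboundary (pull f z.1) := by
  rw [map_ofCocycle, ofCocycle_eq_zero]

theorem exists_ofCocycle (x : SingularCohomology R X) :
    ∃ z : cocycles (singularSet X) R, ofCocycle z = x :=
  Ideal.Quotient.mk_surjective x

end SingularCohomology

end CohomologyClasses

/-! ### Category and products of reduced classes -/

section CupLength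

open Cochains SingularCohomology

variable {R : Type v} [Ring R]

/-- The evaluation on the based path space is homotopic to the constant map to the base point. -/
theorem const_homotopic_basedPathEval (Y : Type u) [TopologicalSpace Y] (y : Y) :
    (ContinuousMap.const (BasedPathSpace Y y) y).Homotopic (basedPathEval Y y) :=
  ⟨{ toFun := fun p => p.2.1 p.1
     continuous_toFun := by fun_prop
     map_zero_left := fun γ => γ.2
     map_one_left := fun γ => rfl }⟩

theorem isCoboundary_pull_const {X Y : Type u} [TopologicalSpace X] [TopologicalSpace Y] {y : Y}
    {c : Cochains (singularSet Y) R}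
    (hc : IsCoboundary (pull (ContinuousMap.const PUnit.{u + 1} y) c)) :
    IsCoboundary (pull (ContinuousMap.const X y) c) :=
  hc.pull (ContinuousMap.const X PUnit.unit)

/-- A cocycle that is a coboundary on a subspace can be replaced by one that vanishes there. -/
theorem exists_ofCocycle_eq_and_pull_eq_zero {Y : Type u} [TopologicalSpace Y] {U : Set Y}
    (z : cocycles (singularSet Y) R) (hz : IsCoboundary (pull (subspaceIncl U) z.1)) :
    ∃ w : cocycles (singularSet Y) R,
      ofCocycle w = ofCocycle z ∧ pull (subspaceIncl U) w.1 = 0 := by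
  obtain ⟨b, hb, hbz⟩ := hz
  refine ⟨⟨z.1 - d (extendZero U b), z.2.1.sub hb.extendZero.d, by
    rw [d_sub, z.2.2, d_d, sub_zero]⟩, ?_, ?_⟩
  · rw [ofCocycle_eq_ofCocycle]
    exact ⟨-extendZero U b, hb.extendZero.neg, by rw [d_neg]; exact (sub_sub_cancel_left _ _).symm⟩
  · rw [map_sub, pull_d, pull_extendZero, hbz, sub_self]

/-- A product of at least as many reduced classes as there are members in an open cover with homotopy
sections of the evaluation of based paths vanishes: its factors have representatives that vanish on
the respective members of the cover, so the product of these vanishes on all small simplices. -/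
theorem prod_eq_zero_of_cover {Y : Type u} [TopologicalSpace Y] {y : Y} {n k : ℕ} (hk : n < k)
    {U : Fin (n + 1) → Set Y} (hU : ∀ i, IsOpen (U i)) (hcov : ⋃ i, U i = Set.univ)
    (hs : ∀ i, ∃ s : C(U i, BasedPathSpace Y y),
      ((basedPathEval Y y).comp s).Homotopic (subspaceIncl (U i)))
    {v : Fin k → SingularCohomology R Y} (hv : ∀ i, v i ∈ reducedCohomology R Y y) :
    (List.ofFn v).prod = 0 := by
  have key : ∀ i : Fin k, ∃ w : cocycles (singularSet Y) R, ofCocycle w = v i ∧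
      ∀ h : i.1 < n + 1, pull (subspaceIncl (U ⟨i.1, h⟩)) w.1 = 0 := fun i => by
    obtain ⟨z, hz⟩ := exists_ofCocycle (v i)
    by_cases h : i.1 < n + 1
    · obtain ⟨s, hs⟩ := hs ⟨i.1, h⟩
      have hz0 : IsCoboundary (pull (ContinuousMap.const PUnit.{u + 1} y) z.1) := by
        rw [← map_ofCocycle_eq_zero, hz]
        exact hv i
      have hH : (subspaceIncl (U ⟨i.1, h⟩)).Homotopic (ContinuousMap.const _ y) :=
        hs.symm.trans ((const_homotopic_basedPathEval Y y).symm.comp (.refl s))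
      obtain ⟨w, hw, hw0⟩ := exists_ofCocycle_eq_and_pull_eq_zero z
        (IsCoboundary.pull_of_homotopic hH z.2.1 z.2.2 (isCoboundary_pull_const hz0))
      exact ⟨w, hw.trans hz, fun _ => hw0⟩
    · exact ⟨z, hz, fun h' => absurd h' h⟩
  choose w hw hw0 using key
  have hprod : (List.ofFn v).prod = ofCocycle (List.ofFn w).prod := by
    change _ = Ideal.Quotient.mk _ _
    rw [map_list_prod, List.map_ofFn]
    congr 2
    exact funext fun i => (hw i).symm
  rw [hprod, ofCocycle_eq_zero]
  obtain ⟨e, he, hde, -⟩ := exists_d_eq_of_pull_subspaceIncl hU hcov (List.ofFn w).prod.2.1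
    (List.ofFn w).prod.2.2 fun i => by
      change ((pull (subspaceIncl (U i))).comp (cocycles (singularSet Y) R).subtype) _ = 0
      rw [map_list_prod, List.map_ofFn]
      refine List.prod_eq_zero (List.mem_ofFn.2 ⟨⟨i.1, by omega⟩, ?_⟩)
      exact hw0 ⟨i.1, by omega⟩ i.2
  exact ⟨e, he, hde⟩

theorem zeroDivisorsCupLength_le_lsCategory {X Y : Type u} [TopologicalSpace X] [TopologicalSpace Y]
    {y : Y} (q : C(X × X, Y)) (hq : Set.SurjOn (SingularCohomology.map R q)
      (reducedCohomology R Y y) (zeroDivisorIdeal R X)) :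
    zeroDivisorsCupLength R X ≤ lsCategory Y y := by
  refine iSup₂_le fun k hk => le_iInf₂ fun n hn => ?_
  obtain ⟨u, hu, hprod⟩ := hk
  obtain ⟨U, hU, hcov, hs⟩ := hn
  rw [Nat.cast_le]
  by_contra! hlt
  choose v hv hvu using fun i => hq (hu i)
  refine hprod ?_
  have : List.ofFn u = (List.ofFn v).map (SingularCohomology.map R q) := by
    rw [List.map_ofFn]
    congr 1
    exact funext fun i => (hvu i).symm
  rw [this, ← map_list_prod, prod_eq_zero_of_cover hlt hU hcov hs hv, map_zero]

end CupLength

/-! ### A Mayer-Vietoris argument for mapping cones -/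

section MayerVietoris

open Cochains SingularCohomology

variable {R : Type v} [Ring R] {A B C : Type u} [TopologicalSpace A] [TopologicalSpace B]
  [TopologicalSpace C]

/-- The theorem of small simplices for a cover by two sets. -/
theorem exists_d_eq_of_pull_two {U V : Set C} (hU : IsOpen U) (hV : IsOpen V)
    (hUV : U ∪ V = Set.univ) {c : Cochains (singularSet C) R} (hb : IsBounded c) (hc : d c = 0)
    (hcU : pull (subspaceIncl U) c = 0) (hcV : pull (subspaceIncl V) c = 0) :
    ∃ e : Cochains (singularSet C) R, IsBounded e ∧ d e = c ∧
      pull (subspaceIncl U) e = 0 ∧ pull (subspaceIncl V) e = 0 := by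
  obtain ⟨e, he, hde, heU⟩ := exists_d_eq_of_pull_subspaceIncl (U := fun b : Bool => cond b U V)
    (fun b => by cases b <;> assumption) (by rw [← Set.union_eq_iUnion, hUV]) hb hc
    (fun b => by cases b <;> assumption)
  exact ⟨e, he, hde, heU true, heU false⟩

/-- A decomposition of `C` into two open sets that is modelled on the mapping cone of `f : A → B`,
with inclusion `q : B → C` and cone point `y`: one set retracts to `B` by a map `r` that is a
deformation in `C`, the other one contracts to `y` in `C`, and the intersection is homotopy
equivalent to `A`. -/
structure ConeDecomposition (f : C(A, B)) (q : C(B, C)) (y : C) where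
  /-- The neighbourhood of `B`. -/
  U : Set C
  /-- The neighbourhood of the cone point. -/
  V : Set C
  isOpen_U : IsOpen U
  isOpen_V : IsOpen V
  union_eq : U ∪ V = Set.univ
  mem_V : y ∈ V
  /-- The map `q` with values in `U`. -/
  qU : C(B, U)
  incl_comp_qU : (subspaceIncl U).comp qU = q
  /-- The retraction of `U` to `B`. -/
  r : C(U, B)
  r_comp_qU : r.comp qU = ContinuousMap.id B
  homotopic_U : (subspaceIncl U).Homotopic (q.comp r)
  homotopic_V : (subspaceIncl V).Homotopic (ContinuousMap.const V y)
  /-- The projection of the intersection to `A`. -/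
  p : C(↥(U ∩ V), A)
  /-- The inclusion of `A` in the intersection. -/
  j : C(A, ↥(U ∩ V))
  r_comp : r.comp (subspaceMap Set.inter_subset_left) = f.comp p
  p_comp_j : p.comp j = ContinuousMap.id A
  homotopic_inter : (j.comp p).Homotopic (ContinuousMap.id _)

namespace ConeDecomposition

variable {f : C(A, B)} {q : C(B, C)} {y : C}

theorem homotopic_const (D : ConeDecomposition f q y) :
    (q.comp f).Homotopic (ContinuousMap.const A y) := by
  have h1 : f = D.r.comp ((subspaceMap Set.inter_subset_left).comp D.j) := by
    rw [← ContinuousMap.comp_assoc, D.r_comp, ContinuousMap.comp_assoc, D.p_comp_j,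
      ContinuousMap.comp_id]
  have h2 : (q.comp f).Homotopic ((subspaceIncl D.U).comp
      ((subspaceMap Set.inter_subset_left).comp D.j)) := by
    conv_lhs => rw [h1, ← ContinuousMap.comp_assoc]
    exact D.homotopic_U.symm.comp (.refl _)
  exact h2.trans (D.homotopic_V.comp (.refl ((subspaceMap Set.inter_subset_right).comp D.j)))

theorem mapsTo (D : ConeDecomposition f q y) :
    Set.MapsTo (SingularCohomology.map R q) (reducedCohomology R C y)
    (RingHom.ker (SingularCohomology.map R f)) := by
  intro x hx
  obtain ⟨z, rfl⟩ := exists_ofCocycle x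
  have hx' : IsCoboundary (pull (ContinuousMap.const PUnit.{u + 1} y) z.1) :=
    map_ofCocycle_eq_zero.1 hx
  change SingularCohomology.map R f (SingularCohomology.map R q (ofCocycle z)) = 0
  rw [map_ofCocycle, map_ofCocycle_eq_zero, ← pull_comp]
  exact IsCoboundary.pull_of_homotopic D.homotopic_const z.2.1 z.2.2 (isCoboundary_pull_const hx')

/-- If `f` has a left inverse, a reduced class of `C` that vanishes on `B` is zero: the primitives
of a representative on the two parts can be made to agree on the intersection, where their difference
extends to a cocycle on `B`. -/
theorem injOn (D : ConeDecomposition f q y) (g : C(B, A)) (hg : g.comp f = ContinuousMap.id A) :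
    Set.InjOn (SingularCohomology.map R q) (reducedCohomology R C y) := by
  have key : ∀ x ∈ reducedCohomology R C y, SingularCohomology.map R q x = 0 → x = 0 := by
    intro x hx hqx
    obtain ⟨z, rfl⟩ := exists_ofCocycle x
    have hx' : IsCoboundary (pull (ContinuousMap.const PUnit.{u + 1} y) z.1) :=
      map_ofCocycle_eq_zero.1 hx
    rw [map_ofCocycle_eq_zero] at hqx
    rw [ofCocycle_eq_zero]
    obtain ⟨c, hcb, hc⟩ := z
    obtain ⟨a, ha, hac⟩ := IsCoboundary.pull_of_homotopic D.homotopic_U hcb hc (hqx.pull D.r)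
    obtain ⟨b, hb, hbc⟩ := IsCoboundary.pull_of_homotopic D.homotopic_V hcb hc
      (isCoboundary_pull_const hx')
    let iU := subspaceMap (Set.inter_subset_left (s := D.U) (t := D.V))
    let iV := subspaceMap (Set.inter_subset_right (s := D.U) (t := D.V))
    have hWU : ∀ c : Cochains (singularSet C) R, pull iU (pull (subspaceIncl D.U) c) =
        pull (subspaceIncl (D.U ∩ D.V)) c := fun _ => rfl
    have hWV : ∀ c : Cochains (singularSet C) R, pull iV (pull (subspaceIncl D.V) c) =
        pull (subspaceIncl (D.U ∩ D.V)) c := fun _ => rfl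
    -- The difference of the two primitives of `c` on the intersection comes from a cocycle on `B`,
    -- because `f` has a left inverse.
    have hwb : IsBounded (pull iU a - pull iV b) := (ha.pull _).sub (hb.pull _)
    have hw : d (pull iU a - pull iV b) = 0 := by
      rw [d_sub, ← pull_d, ← pull_d, hac, hbc, hWU, hWV, sub_self]
    obtain ⟨w, hwdef⟩ : ∃ w, w = pull iU a - pull iV b := ⟨_, rfl⟩
    rw [← hwdef] at hwb hw
    let s := pull g (pull D.j w)
    have hs : d s = 0 := by rw [← pull_d, ← pull_d, hw, map_zero, map_zero]
    have hsw : pull iU (pull D.r s) = pull (D.j.comp D.p) w := by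
      rw [← pull_comp, D.r_comp, pull_comp, ← pull_comp g f, hg, pull_id, ← pull_comp]
    obtain ⟨t, ht, htw⟩ := (isCoboundary_pull_sub D.homotopic_inter hwb hw).neg
    rw [pull_id, neg_sub, ← hsw] at htw
    let a' := a - pull D.r s - d (pull (subspaceIncl D.U) (extendZero (D.U ∩ D.V) t))
    have ha' : IsBounded a' :=
      (ha.sub (((hwb.pull _).pull _).pull _)).sub (ht.extendZero.pull _).d
    have ha'd : d a' = pull (subspaceIncl D.U) c := by
      rw [d_sub, d_sub, d_d, sub_zero, hac, ← pull_d, hs, map_zero, sub_zero]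
    have hglue : pull iU a' = pull iV b := by
      rw [map_sub, map_sub, pull_d, hWU, pull_extendZero, htw, hwdef]
      abel
    obtain ⟨e, he, heU, heV⟩ := exists_glue ha' hb hglue
    obtain ⟨e', he', hde', -, -⟩ := exists_d_eq_of_pull_two D.isOpen_U D.isOpen_V D.union_eq
      (hcb.sub he.d) (by rw [d_sub, hc, d_d, sub_zero])
      (by rw [map_sub, pull_d, heU, ha'd, sub_self]) (by rw [map_sub, pull_d, heV, hbc, sub_self])
    exact ⟨e + e', he.add he', by rw [d_add, hde', add_sub_cancel]⟩
  intro x hx x' hx' h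
  exact sub_eq_zero.1 (key _ (sub_mem hx hx') (by rw [map_sub, h, sub_self]))

/-- A class on `B` that vanishes on `A` comes from `C`: its pullback to the lower part `U` has a
representative that vanishes on the intersection, which extends by zero to `V`. -/
theorem surjOn (D : ConeDecomposition f q y) :
    Set.SurjOn (SingularCohomology.map R q) (reducedCohomology R C y)
    (RingHom.ker (SingularCohomology.map R f)) := by
  intro x hx
  obtain ⟨⟨a, hab, ha⟩, rfl⟩ := exists_ofCocycle x
  obtain ⟨b, hb, hba⟩ := map_ofCocycle_eq_zero.1 hx
  let iU := subspaceMap (Set.inter_subset_left (s := D.U) (t := D.V))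
  -- The pullback of `a` to `U`, corrected so as to vanish on the intersection.
  let k := pull (subspaceIncl D.U) (extendZero (D.U ∩ D.V) (pull D.p b))
  have hk : IsBounded k := (hb.pull _).extendZero.pull _
  let a' := pull D.r a - d k
  have ha' : IsBounded a' := (hab.pull _).sub hk.d
  have hWU : pull iU k = pull D.p b := pull_extendZero _ _
  have ha'W : pull iU a' = 0 := by
    rw [map_sub, pull_d, hWU, ← pull_comp, D.r_comp, pull_comp, ← hba, pull_d, sub_self]
  obtain ⟨c, hc, hcU, hcV⟩ := exists_glue ha' (b := (0 : Cochains (singularSet D.V) R))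
    isBounded_zero (by rw [ha'W, map_zero])
  obtain ⟨e, he, hde, heU, heV⟩ := exists_d_eq_of_pull_two D.isOpen_U D.isOpen_V D.union_eq
    hc.d (d_d c) (by rw [pull_d, hcU, d_sub, d_d, sub_zero, ← pull_d, ha, map_zero])
    (by rw [pull_d, hcV, d_zero])
  refine ⟨ofCocycle ⟨c - e, hc.sub he, by rw [d_sub, hde, sub_self]⟩, ?_, ?_⟩
  · have hy : ContinuousMap.const PUnit.{u + 1} y =
        (subspaceIncl D.V).comp (ContinuousMap.const _ ⟨y, D.mem_V⟩) := rfl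
    refine map_ofCocycle_eq_zero.2 ⟨0, isBounded_zero, ?_⟩
    rw [d_zero, hy, pull_comp, map_sub, hcV, heV, sub_zero, map_zero]
  · rw [map_ofCocycle, ofCocycle_eq_ofCocycle]
    refine ⟨-pull D.qU k, (hk.pull _).neg, ?_⟩
    change _ = pull q (c - e) - a
    have hq : pull q (c - e) = pull D.qU (pull (subspaceIncl D.U) (c - e)) := by
      rw [← pull_comp, D.incl_comp_qU]
    have hr : pull D.qU (pull D.r a) = a := by rw [← pull_comp, D.r_comp_qU, pull_id]
    rw [hq, map_sub, hcU, heU, sub_zero, map_sub, hr, d_neg, pull_d]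
    exact (sub_sub_cancel_left _ _).symm

end ConeDecomposition

end MayerVietoris

/-! ### The topology of the mapping cone -/

section MappingConeTopology

namespace MappingCone

open Cochains

variable {A B : Type u} [TopologicalSpace A] [TopologicalSpace B] (f : C(A, B))

/-- The point of the mapping cone with given coordinates in the cylinder. -/
def cyl (a : A) (t : unitInterval) : MappingCone f := Quot.mk _ (.inr (.inl (a, t)))

theorem continuous_cyl {Y : Type v} [TopologicalSpace Y] {g : Y → A} {t : Y → unitInterval}
    (hg : Continuous g) (ht : Continuous t) : Continuous fun y => cyl f (g y) (t y) :=
  continuous_quot_mk.comp (continuous_inr.comp (continuous_inl.comp (hg.prodMk ht)))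

theorem cyl_zero (a : A) : cyl f a 0 = incl f (f a) := Quot.sound (.base a)

theorem cyl_one (a : A) : cyl f a 1 = apex f := Quot.sound (.tip a)

variable {f}

theorem cases {P : MappingCone f → Prop} (h₁ : ∀ b, P (incl f b)) (h₂ : ∀ a t, P (cyl f a t))
    (h₃ : P (apex f)) (x : MappingCone f) : P x := by
  induction x using Quot.ind with
  | mk x =>
    rcases x with b | ⟨a, t⟩ | ⟨⟩
    exacts [h₁ b, h₂ a t, h₃]

theorem isOpen_iff {s : Set (MappingCone f)} : IsOpen s ↔ IsOpen (incl f ⁻¹' s) ∧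
    IsOpen ((fun p : A × unitInterval => cyl f p.1 p.2) ⁻¹' s) := by
  refine ⟨fun h => ⟨h.preimage (incl f).continuous,
    h.preimage (continuous_cyl f continuous_fst continuous_snd)⟩, fun h => ?_⟩
  refine (isQuotientMap_quot_mk (r := Rel f)).isOpen_preimage.1 ?_
  rw [isOpen_sum_iff, isOpen_sum_iff]
  exact ⟨h.1, h.2, isOpen_discrete _⟩

/-- The function on the mapping cone with given values on the target, the cylinder and the cone
point. -/
def desc {Z : Type v} (β : B → Z) (α : A → unitInterval → Z) (z : Z) (h₀ : ∀ a, α a 0 = β (f a))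
    (h₁ : ∀ a, α a 1 = z) : MappingCone f → Z :=
  Quot.lift (Sum.elim β (Sum.elim (fun p => α p.1 p.2) fun _ => z)) fun _ _ h => by
    cases h with
    | base a => exact h₀ a
    | tip a => exact h₁ a

theorem continuous_desc {Z : Type v} [TopologicalSpace Z] {β : B → Z} {α : A → unitInterval → Z}
    {z : Z} {h₀ : ∀ a, α a 0 = β (f a)} {h₁ : ∀ a, α a 1 = z} (hβ : Continuous β)
    (hα : Continuous fun p : A × unitInterval => α p.1 p.2) : Continuous (desc β α z h₀ h₁) :=
  continuous_quot_lift _ (hβ.sumElim (hα.sumElim continuous_const))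

variable (f)

/-- The height function, which is `0` on the target of `f` and `1` at the cone point. -/
def height : C(MappingCone f, unitInterval) :=
  ⟨desc (fun _ => 0) (fun _ t => t) 1 (fun _ => rfl) fun _ => rfl,
    continuous_desc continuous_const continuous_snd⟩

theorem height_cyl (a : A) (t : unitInterval) : height f (cyl f a t) = t := rfl

/-- A reparametrization of the height, as a family of self-maps of the mapping cone. -/
def reparam (φ : C(unitInterval × unitInterval, unitInterval)) (h₀ : ∀ s, φ (s, 0) = 0)
    (h₁ : ∀ s, φ (s, 1) = 1) : C(MappingCone f, C(unitInterval, MappingCone f)) where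
  toFun := desc (fun b => ContinuousMap.const _ (incl f b))
    (fun a t => ⟨fun s => cyl f a (φ (s, t)), continuous_cyl f (by fun_prop) (by fun_prop)⟩)
    (ContinuousMap.const _ (apex f))
    (fun a => by ext s; simp [h₀, cyl_zero]) (fun a => by ext s; simp [h₁, cyl_one])
  continuous_toFun := continuous_desc
    (ContinuousMap.continuous_const'.comp (incl f).continuous)
    (ContinuousMap.curry ⟨fun p : (A × unitInterval) × unitInterval => cyl f p.1.1 (φ (p.2, p.1.2)),
      continuous_cyl f (by fun_prop) (by fun_prop)⟩).continuous

/-- The homotopy on a subspace of the mapping cone given by a reparametrization of the height. -/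
theorem homotopic_of_reparam (φ : C(unitInterval × unitInterval, unitInterval))
    (h₀ : ∀ s, φ (s, 0) = 0) (h₁ : ∀ s, φ (s, 1) = 1) (hid : ∀ t, φ (0, t) = t)
    {U : Set (MappingCone f)} (g : C(U, MappingCone f))
    (hg : ∀ x : U, reparam f φ h₀ h₁ x.1 1 = g x) : (subspaceIncl U).Homotopic g :=
  ⟨{ toFun := fun p => reparam f φ h₀ h₁ p.2.1 p.1
     continuous_toFun := by fun_prop
     map_zero_left := fun x => by
       change reparam f φ h₀ h₁ x.1 0 = x.1
       refine cases (P := fun x => reparam f φ h₀ h₁ x 0 = x) (fun b => by rfl) (fun a t => ?_)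
         (by rfl) x.1
       change cyl f a (φ (0, t)) = cyl f a t
       rw [hid]
     map_one_left := hg }⟩

/-- The continuous map on a subspace given by a partial function. -/
def ofPartial {Y Z : Type u} [TopologicalSpace Y] [TopologicalSpace Z] (ρ : Y → Option Z)
    (hρ : ∀ s : Set Z, IsOpen s → IsOpen {x | ∃ z ∈ s, ρ x = some z}) (U : Set Y)
    (hU : ∀ x : U, (ρ x).isSome) : C(U, Z) where
  toFun x := (ρ x).get (hU x)
  continuous_toFun := by
    refine continuous_def.2 fun s hs => ?_
    convert (hρ s hs).preimage (continuous_subtype_val (p := fun x => x ∈ U)) using 1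
    refine Set.ext fun x => ?_
    obtain ⟨z, hz⟩ := Option.isSome_iff_exists.1 (hU x)
    simp [hz]

theorem ofPartial_eq {Y Z : Type u} [TopologicalSpace Y] [TopologicalSpace Z] {ρ : Y → Option Z}
    {hρ : ∀ s : Set Z, IsOpen s → IsOpen {x | ∃ z ∈ s, ρ x = some z}} {U : Set Y}
    {hU : ∀ x : U, (ρ x).isSome} {x : U} {z : Z} (h : ρ x = some z) :
    ofPartial ρ hρ U hU x = z := Option.get_of_eq_some _ h

open scoped Classical in
/-- The partial retraction of the mapping cone to the target of `f`, defined off the cone point. -/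
noncomputable def toTarget : MappingCone f → Option B :=
  desc some (fun a t => if t = 1 then none else some (f a)) none (fun a => by simp) (by simp)

open scoped Classical in
/-- The partial projection of the mapping cone to the source of `f`, defined strictly between the
target and the cone point. -/
noncomputable def toSource : MappingCone f → Option A :=
  desc (fun _ => none) (fun a t => if t = 0 ∨ t = 1 then none else some a) none
    (fun a => by simp) (by simp)

theorem toTarget_incl (b : B) : toTarget f (incl f b) = some b := rfl

theorem toTarget_cyl (a : A) {t : unitInterval} (ht : t ≠ 1) :
    toTarget f (cyl f a t) = some (f a) := if_neg ht

theorem toSource_cyl (a : A) {t : unitInterval} (h₀ : t ≠ 0) (h₁ : t ≠ 1) :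
    toSource f (cyl f a t) = some a := if_neg (not_or.2 ⟨h₀, h₁⟩)

theorem isOpen_toTarget {s : Set B} (hs : IsOpen s) :
    IsOpen {x | ∃ z ∈ s, toTarget f x = some z} := by
  refine isOpen_iff.2 ⟨?_, ?_⟩
  · convert hs using 1
    ext b
    simp [toTarget_incl]
  · convert (isOpen_compl_singleton (x := (1 : unitInterval))).preimage continuous_snd |>.inter
      ((hs.preimage f.continuous).preimage continuous_fst) using 1
    ext ⟨a, t⟩
    by_cases h : t = 1
    · simp [h, cyl_one, show toTarget f (apex f) = none from rfl]
    · simp [h, toTarget_cyl f a h]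

theorem isOpen_toSource {s : Set A} (hs : IsOpen s) :
    IsOpen {x | ∃ z ∈ s, toSource f x = some z} := by
  refine isOpen_iff.2 ⟨?_, ?_⟩
  · convert isOpen_empty (X := B) using 1
    ext b
    simp [show toSource f (incl f b) = none from rfl]
  · convert ((Set.toFinite {(0 : unitInterval), 1}).isClosed.isOpen_compl.preimage
      continuous_snd).inter (hs.preimage continuous_fst) using 1
    ext ⟨a, t⟩
    by_cases h : t = 0 ∨ t = 1
    · simp [h, show toSource f (cyl f a t) = none from if_pos h]
    · have := toSource_cyl f a (not_or.1 h).1 (not_or.1 h).2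
      simp [h, this]

/-- The part of the mapping cone of height less than `2/3`. -/
def lowerPart : Set (MappingCone f) := {x | (height f x : ℝ) < 2 / 3}

/-- The part of the mapping cone of height more than `1/3`. -/
def upperPart : Set (MappingCone f) := {x | 1 / 3 < (height f x : ℝ)}

theorem cyl_mem_inter {a : A} {t : unitInterval} :
    cyl f a t ∈ lowerPart f ∩ upperPart f ↔ (t : ℝ) < 2 / 3 ∧ 1 / 3 < (t : ℝ) := Iff.rfl

theorem incl_mem_lowerPart (b : B) : incl f b ∈ lowerPart f := by
  change (0 : ℝ) < 2 / 3
  norm_num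

theorem apex_mem_upperPart : apex f ∈ upperPart f := by
  change 1 / 3 < (1 : ℝ)
  norm_num

theorem ne_one_of_lt {t : unitInterval} (h : (t : ℝ) < 2 / 3) : t ≠ 1 := by
  rintro rfl
  norm_num at h

theorem ne_zero_of_lt {t : unitInterval} (h : 1 / 3 < (t : ℝ)) : t ≠ 0 := by
  rintro rfl
  norm_num at h

theorem apex_notMem_lowerPart : apex f ∉ lowerPart f := fun h => by
  have h : (1 : ℝ) < 2 / 3 := h
  norm_num at h

theorem incl_notMem_upperPart (b : B) : incl f b ∉ upperPart f := fun h => by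
  have h : 1 / 3 < (0 : ℝ) := h
  norm_num at h

/-- The retraction of the lower part to the target of `f`. -/
noncomputable def retraction : C(lowerPart f, B) :=
  ofPartial (toTarget f) (fun _ => isOpen_toTarget f) _ <| by
    rintro ⟨x, hx⟩
    induction x using cases with
    | h₁ b => rfl
    | h₂ a t => exact Option.isSome_iff_exists.2 ⟨_, toTarget_cyl f a (ne_one_of_lt hx)⟩
    | h₃ => exact (apex_notMem_lowerPart f hx).elim

theorem retraction_incl (b : B) (h : incl f b ∈ lowerPart f) : retraction f ⟨incl f b, h⟩ = b :=
  ofPartial_eq rfl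

theorem retraction_cyl (a : A) (t : unitInterval) (h : cyl f a t ∈ lowerPart f) :
    retraction f ⟨cyl f a t, h⟩ = f a :=
  ofPartial_eq (toTarget_cyl f a (ne_one_of_lt h))

theorem exists_cyl_eq {x : MappingCone f} (h : x ∈ lowerPart f ∩ upperPart f) :
    ∃ a, x = cyl f a (height f x) := by
  induction x using cases with
  | h₁ b => exact (incl_notMem_upperPart f b h.2).elim
  | h₂ a t => exact ⟨a, rfl⟩
  | h₃ => exact (apex_notMem_lowerPart f h.1).elim

/-- The projection of the intersection of the lower and the upper part to the source of `f`. -/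
noncomputable def projection : C(↥(lowerPart f ∩ upperPart f), A) :=
  ofPartial (toSource f) (fun _ => isOpen_toSource f) _ <| by
    rintro ⟨x, hx⟩
    obtain ⟨a, ha⟩ := exists_cyl_eq f hx
    dsimp only
    rw [ha, toSource_cyl f a (ne_zero_of_lt hx.2) (ne_one_of_lt hx.1)]
    rfl

theorem projection_cyl (a : A) (t : unitInterval) (h : cyl f a t ∈ lowerPart f ∩ upperPart f) :
    projection f ⟨cyl f a t, h⟩ = a :=
  ofPartial_eq (toSource_cyl f a (ne_zero_of_lt h.2) (ne_one_of_lt h.1))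

theorem cyl_projection (x : ↥(lowerPart f ∩ upperPart f)) :
    cyl f (projection f x) (height f x.1) = x := by
  obtain ⟨x, hx⟩ := x
  obtain ⟨a, ha⟩ := exists_cyl_eq f hx
  obtain ⟨t, rfl⟩ : ∃ t, x = cyl f a t := ⟨_, ha⟩
  rw [projection_cyl, height_cyl]

/-- The inclusion of the source of `f` at height `1/2`. -/
noncomputable def middle : C(A, ↥(lowerPart f ∩ upperPart f)) :=
  have h : ∀ a, cyl f a ⟨1 / 2, by norm_num, by norm_num⟩ ∈ lowerPart f ∩ upperPart f := fun a =>
    (cyl_mem_inter f).2 ⟨by norm_num, by norm_num⟩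
  ⟨fun a => ⟨_, h a⟩, Continuous.subtype_mk (continuous_cyl f continuous_id continuous_const) h⟩

theorem middle_comp_projection_homotopic :
    ((middle f).comp (projection f)).Homotopic (ContinuousMap.id _) := by
  have hb : ∀ (s : unitInterval) (x : ↥(lowerPart f ∩ upperPart f)),
      (1 - (s : ℝ)) * (1 / 2) + s * (height f x.1 : ℝ) < 2 / 3 ∧
        1 / 3 < (1 - (s : ℝ)) * (1 / 2) + s * (height f x.1 : ℝ) := fun s x => by
    have h1 : (height f x.1 : ℝ) < 2 / 3 := x.2.1
    have h2 : 1 / 3 < (height f x.1 : ℝ) := x.2.2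
    have h3 := s.2.1
    have h4 := s.2.2
    constructor <;> nlinarith
  refine ⟨{
    toFun := fun p => ⟨cyl f (projection f p.2)
      ⟨(1 - (p.1 : ℝ)) * (1 / 2) + p.1 * (height f p.2.1 : ℝ),
        by linarith [(hb p.1 p.2).2], by linarith [(hb p.1 p.2).1]⟩, hb p.1 p.2⟩
    continuous_toFun := Continuous.subtype_mk (continuous_cyl f (by fun_prop) (by fun_prop)) _
    map_zero_left := fun x => Subtype.ext ?_
    map_one_left := fun x => Subtype.ext ?_ }⟩
  · exact congrArg (cyl f (projection f x)) (Subtype.ext (by simp))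
  · refine Eq.trans ?_ (cyl_projection f x)
    exact congrArg (cyl f (projection f x)) (Subtype.ext (by simp))

theorem lowerPart_homotopic :
    (subspaceIncl (lowerPart f)).Homotopic ((incl f).comp (retraction f)) := by
  -- At time `s`, the height `t` is pushed down to `(1 - s) t + s (3 t - 2)`, cut off at `0`.
  refine homotopic_of_reparam f
    ⟨fun p => Set.projIcc (0 : ℝ) 1 zero_le_one ((p.2 : ℝ) + p.1 * (2 * p.2 - 2)),
      continuous_projIcc.comp (by fun_prop)⟩ (fun s => ?_) (fun s => ?_) (fun t => ?_) _ ?_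
  · refine Set.projIcc_of_le_left zero_le_one ?_
    have := s.2.1
    simp only [Set.Icc.coe_zero]; linarith
  · exact Set.projIcc_of_right_le zero_le_one (by simp)
  · simp
  · rintro ⟨x, hx⟩
    rw [ContinuousMap.comp_apply]
    induction x using cases with
    | h₁ b => rw [retraction_incl]; rfl
    | h₂ a t =>
      rw [retraction_cyl, ← cyl_zero]
      refine congrArg (cyl f a) (Set.projIcc_of_le_left zero_le_one ?_)
      have : (t : ℝ) < 2 / 3 := hx
      simp only [Set.Icc.coe_one]; linarith
    | h₃ => exact (apex_notMem_lowerPart f hx).elim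

theorem upperPart_homotopic :
    (subspaceIncl (upperPart f)).Homotopic (ContinuousMap.const _ (apex f)) := by
  -- At time `s`, the height `t` is pulled up to `(1 - s) t + 3 s t`, cut off at `1`.
  refine homotopic_of_reparam f
    ⟨fun p => Set.projIcc (0 : ℝ) 1 zero_le_one ((p.2 : ℝ) + 2 * p.1 * p.2),
      continuous_projIcc.comp (by fun_prop)⟩ (fun s => ?_) (fun s => ?_) (fun t => ?_) _ ?_
  · exact Set.projIcc_of_le_left zero_le_one (by simp)
  · refine Set.projIcc_of_right_le zero_le_one ?_
    have := s.2.1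
    simp only [Set.Icc.coe_one]; linarith
  · simp
  · rintro ⟨x, hx⟩
    rw [ContinuousMap.const_apply]
    induction x using cases with
    | h₁ b => exact (incl_notMem_upperPart f b hx).elim
    | h₂ a t =>
      rw [← cyl_one f a]
      refine congrArg (cyl f a) (Set.projIcc_of_right_le zero_le_one ?_)
      have : 1 / 3 < (t : ℝ) := hx
      simp only [Set.Icc.coe_one]; linarith
    | h₃ => rfl

/-- The decomposition of the mapping cone by height. -/
noncomputable def coneDecomposition : ConeDecomposition f (incl f) (apex f) where
  U := lowerPart f
  V := upperPart f
  isOpen_U := isOpen_lt (by fun_prop) continuous_const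
  isOpen_V := isOpen_lt continuous_const (by fun_prop)
  union_eq := Set.eq_univ_of_forall fun x => by
    rcases lt_or_ge (height f x : ℝ) (2 / 3) with h | h
    · exact Or.inl h
    · exact Or.inr (lt_of_lt_of_le (by norm_num) h)
  mem_V := apex_mem_upperPart f
  qU := ⟨fun b => ⟨incl f b, incl_mem_lowerPart f b⟩, (incl f).continuous.subtype_mk _⟩
  incl_comp_qU := rfl
  r := retraction f
  r_comp_qU := by ext b; exact retraction_incl f b (incl_mem_lowerPart f b)
  homotopic_U := lowerPart_homotopic f
  homotopic_V := upperPart_homotopic f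
  p := projection f
  j := middle f
  r_comp := by
    ext ⟨x, hx⟩
    obtain ⟨a, ha⟩ := exists_cyl_eq f hx
    obtain ⟨t, rfl⟩ : ∃ t, x = cyl f a t := ⟨_, ha⟩
    exact (retraction_cyl f a t _).trans (congrArg f (projection_cyl f a t hx).symm)
  p_comp_j := by ext a; exact projection_cyl f a _ (middle f a).2
  homotopic_inter := middle_comp_projection_homotopic f

end MappingCone

end MappingConeTopology

theorem mainTheorem10 (X : Type u) [TopologicalSpace X] (R : Type v) [Ring R] :
    zeroDivisorsCupLength R X
        ≤ lsCategory (MappingCone (diagonalMap X)) (MappingCone.apex (diagonalMap X)) ∧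
      Set.BijOn (SingularCohomology.map R (MappingCone.incl (diagonalMap X)))
        (reducedCohomology R (MappingCone (diagonalMap X)) (MappingCone.apex (diagonalMap X)))
        (zeroDivisorIdeal R X) := by
  have D := MappingCone.coneDecomposition (diagonalMap X)
  exact ⟨zeroDivisorsCupLength_le_lsCategory _ (D.surjOn),
    D.mapsTo, D.injOn ContinuousMap.fst rfl, D.surjOn⟩
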